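/- **Theorem 2 (Quality of Thinformer).** Let $d\ge 1$, $g\ge 0$, $m\ge 1$ be integers, $n=n_{\rm in}=4^{g+m}$ and $n_{\rm out}=2^{g}\sqrt{n}=2^g2^{g+m}$ (so $\sqrt n\le n_{\rm out}<n$). Let $q_i,k_i,v_i\in\mathbb R^d$ ($1\le i\le n$) be queries, keys and values, let $V\in\mathbb R^{n\times d}$ have rows $v_i$, and let $\|\cdot\|_{\max}$ and $\|\cdot\|_{2,\infty}$ denote the largest absolute entry and the largest Euclidean row norm of a matrix. For a nonempty finite family of key-value pairs $(k_j,v_j)_{j\in J}$, let $\mathrm{Attention}((q_i),(k_j,v_j)_{j\in J})=D^{-1}AV_J$, where $A_{ij}=\exp(\langle q_i,k_j\rangle/\sqrt d)$, $D=\mathrm{diag}(A\mathbf 1)$ and $V_J$ has rows $v_j$; let $T=\mathrm{Attention}((q_i),(k_j,v_j)_{j=1}^n)$. *Kernel halving.* For a kernel $\kappa$, $\delta>0$ and a sequence $x_1,\dots,x_N$ with $N$ even, $\mathrm{KH}(\delta)$ starts with empty sequences $S_1,S_2$ and $b_{\max}=0$. For $i=1,\dots,N/2$ it takes $(x,x')=(x_{2i-1},x_{2i})$,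 $b=\sqrt{\kappa(x,x)+\kappa(x',x')-2\kappa(x,x')}$, replaces $b_{\max}$ by $\max(b,b_{\max})$, sets $a=b\,b_{\max}(\tfrac12+\log(2N/\delta))$ and $\alpha=\sum_{j\le 2i-2}(\kappa(x_j,x)-\kappa(x_j,x'))-2\sum_{z\in S_1}(\kappa(z,x)-\kappa(z,x'))$, swaps $x$ and $x'$ with probability $\min(1,\tfrac12(1-\alpha/a)_+)$ (with probability $\tfrac12$ if $a=0$), using fresh randomness, and then appends $x$ to $S_1$ and $x'$ to $S_2$. The output is $S_1$. *KH-Compress($\delta$).* On a sequence of length $n$ it returns $\mathrm{compress}$ of that sequence, where $\mathrm{compress}(S)=S$ if $|S|=4^g$. Otherwise $\mathrm{compress}$ partitions $S$ into four subsequences of length $|S|/4$, in an arbitrary fixed way, applies itself to each of them with independent randomness, concatenates the four results, and returns the output of $\mathrm{KH}\big(\frac{\ell^2}{n\,4^{g+1}(\log_4 n-g)}\delta\big)$ on the concatenation, with $\ell=2\cdot2^g\sqrt{|S|}$. *Thinformer.* Let $v_{\max}=\|V\|_{\max}$. Run KH-Compress($0.5$) on the sequence of points $(\tilde k_i,\tilde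 v_i)=(k_i/d^{1/4},(v_i,v_{\max}))$, $1\le i\le n$, with the key-value attention kernel $\kappa((\tilde k,\tilde v),(\tilde k',\tilde v'))=\exp(\langle\tilde k,\tilde k'\rangle)\langle\tilde v,\tilde v'\rangle$, and let $\hat T$ be the attention of all the queries over the $n_{\rm out}$ selected key-value pairs $(k_i,v_i)$. Then, with probability at least $\frac12$, $$\|\hat T-T\|_{\max}\le \frac{c\,\exp\!\big(\tfrac{2R^2}{\sqrt d}\big)\,\|V\|_{2,\infty}\sqrt{\log_2(n_{\rm out})\,\log\!\big(8n_{\rm out}\log_2\tfrac{n_{\rm in}}{n_{\rm out}}\big)}}{n_{\rm out}},$$ where $R=\max_{i}\max(\|k_i\|_2,\|q_i\|_2)$ and $$c=\tfrac{128}{\sqrt3}\sqrt{(d+1)\log\!\Big(3e^2\max\big(1,(\tfrac{R^2}{\sqrt d}+2)\|V\|_{\max}\big)\Big)}+\sqrt{\log 8}\,\Big(4+\tfrac{128}{\sqrt3}\Big).$$ -/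

import Mathlib

open scoped NNReal ENNReal

noncomputable section

namespace Thinformer

/-! ### Kernel halving -/

/-- A coin that lands `true` with probability `min 1 (max 0 p)`. -/
def coin (p : ℝ) : PMF Bool :=
  PMF.ofFintype
    (fun b => cond b (min 1 (ENNReal.ofReal p)) (1 - min 1 (ENNReal.ofReal p)))
    (by simp)

/-- The rounds of kernel halving. The arguments are the kernel `κ`, the constant
`τ = 1/2 + log (2 n_in / δ)`, the list `seen` of points already processed, the first coreset `S₁`,
the largest function norm so far, and the points still to be processed.

In each round, with `f = κ(x, ·) - κ(x', ·)`, the number `b` is the RKHS norm of `f`, the number `a`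
is the swapping threshold, and `α` is the RKHS inner product of `f` with
`∑_{z ∈ S₂} κ(z, ·) - ∑_{z ∈ S₁} κ(z, ·) = ∑_{z ∈ seen} κ(z, ·) - 2 ∑_{z ∈ S₁} κ(z, ·)`.
The point `x'` (after a swap) or `x` (without one) joins `S₁`. If `a = 0`, then `f = 0`, and the
swap has probability `1/2`. -/
def khLoop {X : Type*} (κ : X → X → ℝ) (τ : ℝ) : List X → List X → ℝ → List X → PMF (List X)
  | seen, S₁, bmax, x :: x' :: rest =>
    let b : ℝ := √(κ x x + κ x' x' - 2 * κ x x')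
    let bmax' : ℝ := max b bmax
    let a : ℝ := b * bmax' * τ
    let α : ℝ := (seen.map fun z => κ z x - κ z x').sum
      - 2 * (S₁.map fun z => κ z x - κ z x').sum
    (coin (1 / 2 * max 0 (1 - α / a))).bind fun swap =>
      khLoop κ τ (seen ++ [x, x']) (S₁ ++ [if swap then x' else x]) bmax' rest
  | _, S₁, _, _ => PMF.pure S₁

/-- The output distribution of kernel halving `KH(δ)` on a sequence of even length. -/
def kernelHalving {X : Type*} (κ : X → X → ℝ) (δ : ℝ) (S : List X) : PMF (List X) :=
  khLoop κ (1 / 2 + Real.log (2 * (S.length : ℝ) / δ)) [] [] 0 S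

/-! ### The recursive compression algorithm -/

/-- A rule for partitioning a sequence whose length is a multiple of four into four subsequences
of equal length. -/
structure QuarteringRule (X : Type*) where
  /-- The four parts of a sequence. -/
  part : List X → Fin 4 → List X
  sublist : ∀ S : List X, 4 ∣ S.length → ∀ i, (part S i).Sublist S
  length_part : ∀ S : List X, 4 ∣ S.length → ∀ i, (part S i).length = S.length / 4
  perm : ∀ S : List X, 4 ∣ S.length →
    (part S 0 ++ part S 1 ++ part S 2 ++ part S 3).Perm S

/-- The recursive function `compress`, on a sequence of length `4 ^ (g + r)`, where `r` counts the
remaining levels of the recursion: the sequence is returned unchanged when its length is `4 ^ g`.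
The four recursive calls use independent randomness. Here `nin` is the length of the sequence on
which the whole algorithm was started and `δ` is the overall failure probability. -/
def compress {X : Type*} (P : QuarteringRule X) (κ : X → X → ℝ) (δ : ℝ) (nin g : ℕ) :
    ℕ → List X → PMF (List X)
  | 0, S => PMF.pure S
  | r + 1, S =>
    (compress P κ δ nin g r (P.part S 0)).bind fun S₀ =>
    (compress P κ δ nin g r (P.part S 1)).bind fun S₁ =>
    (compress P κ δ nin g r (P.part S 2)).bind fun S₂ =>
    (compress P κ δ nin g r (P.part S 3)).bind fun S₃ =>
      let ℓ : ℝ := 2 * 2 ^ g * √(S.length : ℝ)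
      kernelHalving κ
        (ℓ ^ 2 / ((nin : ℝ) * 4 ^ (g + 1) * (Real.logb 4 (nin : ℝ) - (g : ℝ))) * δ)
        (S₀ ++ S₁ ++ S₂ ++ S₃)

/-- The output distribution of `KH-Compress(δ)` with compression level `g` on a sequence `S` of
length `4 ^ (g + m)`; the output has length `2 ^ g * √(4 ^ (g + m)) = 2 ^ g * 2 ^ (g + m)`. -/
def khCompress {X : Type*} (P : QuarteringRule X) (κ : X → X → ℝ) (δ : ℝ) (g m : ℕ)
    (S : List X) : PMF (List X) :=
  compress P κ δ S.length g m S

/-! ### Attention -/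

/-- The largest absolute value of an entry of a matrix. -/
def maxNorm {ι κ : Type*} (M : Matrix ι κ ℝ) : ℝ := ⨆ i, ⨆ j, |M i j|

/-- The matrix whose rows are the given vectors. -/
def rowsMatrix {ι : Type*} {d : ℕ} (v : ι → EuclideanSpace ℝ (Fin d)) : Matrix ι (Fin d) ℝ :=
  Matrix.of fun i j => v i j

/-- The largest Euclidean norm of a row of a matrix. -/
def rowNorm {ι : Type*} {d : ℕ} (M : Matrix ι (Fin d) ℝ) : ℝ :=
  ⨆ i, ‖WithLp.toLp 2 (M i)‖

/-- The matrix `A` with entries `exp (⟨q_i, k_j⟩ / √d)`. -/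
def attentionMatrix {ι κ : Type*} {d : ℕ} (q : ι → EuclideanSpace ℝ (Fin d))
    (k : κ → EuclideanSpace ℝ (Fin d)) : Matrix ι κ ℝ :=
  Matrix.of fun i j => Real.exp (inner ℝ (q i) (k j) / √(d : ℝ))

/-- Dot-product attention `D⁻¹ A V` with `D = diag (A 1)`. -/
def attention {ι κ : Type*} [Fintype ι] [DecidableEq ι] [Fintype κ] {d : ℕ}
    (q : ι → EuclideanSpace ℝ (Fin d)) (k v : κ → EuclideanSpace ℝ (Fin d)) :
    Matrix ι (Fin d) ℝ :=
  Matrix.diagonal (fun i => (∑ j, attentionMatrix q k i j)⁻¹) * attentionMatrix q k * rowsMatrix v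

/-- The key-value attention kernel `exp ⟨k, k'⟩ ⟨v, v'⟩`. -/
def attentionKernel {d e : ℕ} (x y : EuclideanSpace ℝ (Fin d) × EuclideanSpace ℝ (Fin e)) : ℝ :=
  Real.exp (inner ℝ x.1 y.1) * inner ℝ x.2 y.2

/-- The augmented key-value pairs `(k_i / d ^ (1/4), (v_i, v_max))`, where `v_max` is the largest
absolute value of a coordinate of a value vector. -/
def augmentedPair {n d : ℕ} (k v : Fin n → EuclideanSpace ℝ (Fin d)) (i : Fin n) :
    EuclideanSpace ℝ (Fin d) × EuclideanSpace ℝ (Fin (d + 1)) :=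
  (((d : ℝ) ^ (1 / 4 : ℝ))⁻¹ • k i,
    WithLp.toLp 2 (Fin.snoc (α := fun _ => ℝ) (v i) (maxNorm (rowsMatrix v))))

/-- The distribution of the Thinformer output: the sequence of augmented key-value pairs, each
represented by its index, is thinned by `KH-Compress(0.5)` with the attention kernel, and exact
attention is computed on the selected key-value pairs. -/
def thinformer {n d : ℕ} (P : QuarteringRule (Fin n)) (g m : ℕ)
    (q k v : Fin n → EuclideanSpace ℝ (Fin d)) : PMF (Matrix (Fin n) (Fin d) ℝ) :=
  (khCompress P (fun i j => attentionKernel (augmentedPair k v i) (augmentedPair k v j))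
      0.5 g m (List.finRange n)).map
    fun out => attention q (fun l : Fin out.length => k (out.get l))
      (fun l : Fin out.length => v (out.get l))

/-- `R`, the largest Euclidean norm of a query or key. -/
def radius {n d : ℕ} (q k : Fin n → EuclideanSpace ℝ (Fin d)) : ℝ :=
  ⨆ i, max ‖k i‖ ‖q i‖

/-- The factor `c`, as a function of the dimension `d`, the radius `R` and `vmax = ‖V‖_max`. -/
def errorConstant (d : ℕ) (R vmax : ℝ) : ℝ :=
  128 / √3 * √(((d : ℝ) + 1) *
      Real.log (3 * Real.exp 1 ^ 2 * max 1 ((R ^ 2 / √(d : ℝ) + 2) * vmax)))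
    + √(Real.log 8) * (4 + 128 / √3)

end Thinformer

end

open scoped NNReal ENNReal

noncomputable section

namespace Thinformer

/-! ### Sub-Gaussian random vectors, up to an event of small probability -/

section Pmf

variable {α β : Type*}

/-! Write the kernel as an inner product of features `Φ`. The argument bounds `D = ∑ Φ - 2^m ∑ Φ`,
the first sum over all pairs and the second over the selected ones, where `2^m = n_in / n_out`.
Three ingredients give the theorem.

Sub-Gaussianity. After discarding a small part of the distribution, `E exp ⟨D, u⟩ ≤ exp (V ‖u‖² /
2)`. In one call of kernel halving the drift of each coin contracts the test vector just enough to
absorb the noise of that coin, so the variance proxy does not grow with the number of rounds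
(`khRound_weightedSubGaussian`). Along the recursion proxies and discarded masses add, which gives
`V = 2 m 4^m K L` and a discarded mass `1/4` (`compress_subGaussianOff`).

Uniformity over queries. The features live in a Fock space, where a numerator or denominator of
attention is, up to a known factor, the pairing with a coherent vector `∑ z^{⊗p} ⊗ v / √p!`. In each
degree, multilinearity and a grid whose convex hull contains the unit ball reduce all `z` to
finitely many tensors. A union bound over degrees, grid tensors and value coordinates costs another
`1/4` (`WeightedSubGaussian.tsum_exceeds_le`) and controls every query, of any norm, at once
(`abs_inner_coherent_le`).

Ratio. The last value coordinate is constantly `v_max`, so the same estimate controls the error of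
the softmax denominator. Centring the features at the mean key makes the error match Jensen's lower
bound for that denominator; the loss is `exp (3R²/(2√d))`, and the feature norm contributes the
remaining `exp (R²/(2√d))` (`abs_softmax_sub_le`, `deviation_le_bound`). -/

theorem tsum_pmf_bind_mul (p : PMF α) (q : α → PMF β) (F : β → ℝ≥0∞) :
    ∑' b, (p.bind q) b * F b = ∑' a, p a * ∑' b, q a b * F b := by
  simp_rw [PMF.bind_apply, ← ENNReal.tsum_mul_right, ← ENNReal.tsum_mul_left]
  rw [ENNReal.tsum_comm]
  simp_rw [mul_assoc]

theorem tsum_pmf_pure_mul (a : α) (F : α → ℝ≥0∞) : ∑' b, PMF.pure a b * F b = F a := by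
  rw [tsum_eq_single a]
  · simp
  · intro b hb
    simp [PMF.pure_apply, hb]

theorem tsum_pmf_map_mul (p : PMF α) (f : α → β) (F : β → ℝ≥0∞) :
    ∑' b, (p.map f) b * F b = ∑' a, p a * F (f a) := by
  rw [PMF.map, tsum_pmf_bind_mul]
  simp

variable {H : Type*} [NormedAddCommGroup H] [InnerProductSpace ℝ H]

/-- Under the weights `μ`, the vector `D` has the exponential moments of a centred Gaussian vector
with covariance `V • 1`, up to a factor at most one. -/
def WeightedSubGaussian (μ : α → ℝ≥0∞) (D : α → H) (V : ℝ) : Prop :=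
  ∀ u : H, ∑' a, μ a * ENNReal.ofReal (Real.exp (inner ℝ (D a) u)) ≤
    ENNReal.ofReal (Real.exp (V * ‖u‖ ^ 2 / 2))

/-- The random vector `D` is sub-Gaussian with variance proxy `V` once a part of the distribution
`p` of mass at most `ε` is discarded. -/
def SubGaussianOff (p : PMF α) (D : α → H) (V : ℝ) (ε : ℝ≥0∞) : Prop :=
  ∃ μ : α → ℝ≥0∞, (∀ a, μ a ≤ p a) ∧ 1 ≤ (∑' a, μ a) + ε ∧ WeightedSubGaussian μ D V

theorem WeightedSubGaussian.mono {μ : α → ℝ≥0∞} {D : α → H} {V V' : ℝ}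
    (h : WeightedSubGaussian μ D V) (hV : V ≤ V') : WeightedSubGaussian μ D V' := fun u =>
  (h u).trans <| ENNReal.ofReal_le_ofReal <| Real.exp_le_exp.2 <| by gcongr

theorem WeightedSubGaussian.smul {μ : α → ℝ≥0∞} {D : α → H} {V : ℝ}
    (h : WeightedSubGaussian μ D V) (c : ℝ) :
    WeightedSubGaussian μ (fun a => c • D a) (c ^ 2 * V) := fun u => by
  have := h (c • u)
  simp only [inner_smul_right, norm_smul, mul_pow, Real.norm_eq_abs, sq_abs] at this
  simp only [inner_smul_left, RCLike.conj_to_real]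
  refine this.trans (le_of_eq ?_)
  ring_nf

theorem SubGaussianOff.mono {p : PMF α} {D : α → H} {V V' : ℝ} {ε ε' : ℝ≥0∞}
    (h : SubGaussianOff p D V ε) (hV : V ≤ V') (hε : ε ≤ ε') : SubGaussianOff p D V' ε' := by
  obtain ⟨μ, h1, h2, h3⟩ := h
  exact ⟨μ, h1, h2.trans (by gcongr), h3.mono hV⟩

theorem SubGaussianOff.smul {p : PMF α} {D : α → H} {V : ℝ} {ε : ℝ≥0∞}
    (h : SubGaussianOff p D V ε) (c : ℝ) :
    SubGaussianOff p (fun a => c • D a) (c ^ 2 * V) ε := by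
  obtain ⟨μ, h1, h2, h3⟩ := h
  exact ⟨μ, h1, h2, h3.smul c⟩

theorem SubGaussianOff.pure (a : α) {D : α → H} (hD : D a = 0) :
    SubGaussianOff (PMF.pure a) D 0 0 := by
  refine ⟨PMF.pure a, fun _ => le_rfl, by simp, fun u => ?_⟩
  rw [tsum_pmf_pure_mul]
  simp [hD]

/-- Tower rule: conditionally on `a`, the increment has its own exponential moment bound, so the
exponents add. Working with sub-weights instead of conditioning on a good event keeps the moment
bounds exact, and the discarded masses simply add. -/
theorem SubGaussianOff.bind {p : PMF α} {q : α → PMF β} {D : α → H} {D' : β → H} {V V' : ℝ}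
    {ε ε' : ℝ≥0∞} (hp : SubGaussianOff p D V ε)
    (hq : ∀ a ∈ p.support, SubGaussianOff (q a) (fun b => D' b - D a) V' ε') :
    SubGaussianOff (p.bind q) D' (V + V') (ε + ε') := by
  classical
  obtain ⟨μ, h1, h2, h3⟩ := hp
  have hex : ∀ a, ∃ ν : β → ℝ≥0∞, a ∈ p.support → (∀ b, ν b ≤ q a b) ∧
      1 ≤ (∑' b, ν b) + ε' ∧ WeightedSubGaussian ν (fun b => D' b - D a) V' := fun a => by
    by_cases ha : a ∈ p.support
    · obtain ⟨ν, hν⟩ := hq a ha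
      exact ⟨ν, fun _ => hν⟩
    · exact ⟨0, fun h => absurd h ha⟩
  choose ν hν using hex
  have hzero : ∀ a, a ∉ p.support → μ a = 0 := fun a ha => by
    have := h1 a
    rw [(PMF.apply_eq_zero_iff p a).2 ha] at this
    exact le_antisymm this bot_le
  have hμ1 : ∑' a, μ a ≤ 1 := by
    rw [← p.tsum_coe]
    exact ENNReal.tsum_le_tsum h1
  refine ⟨fun b => ∑' a, μ a * ν a b, fun b => ?_, ?_, fun u => ?_⟩
  · rw [PMF.bind_apply]
    refine ENNReal.tsum_le_tsum fun a => ?_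
    by_cases ha : a ∈ p.support
    · exact mul_le_mul' (h1 a) ((hν a ha).1 b)
    · simp [hzero a ha]
  · rw [ENNReal.tsum_comm]
    simp_rw [ENNReal.tsum_mul_left]
    have key : ∑' a, μ a ≤ (∑' a, μ a * ∑' b, ν a b) + ε' := by
      calc ∑' a, μ a ≤ ∑' a, (μ a * (∑' b, ν a b) + μ a * ε') := by
            refine ENNReal.tsum_le_tsum fun a => ?_
            by_cases ha : a ∈ p.support
            · rw [← mul_add]
              exact le_mul_of_one_le_right' (hν a ha).2.1
            · simp [hzero a ha]
        _ = (∑' a, μ a * ∑' b, ν a b) + (∑' a, μ a) * ε' := by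
            rw [ENNReal.tsum_add, ENNReal.tsum_mul_right]
        _ ≤ _ := by
            gcongr
            exact mul_le_of_le_one_left' hμ1
    calc 1 ≤ (∑' a, μ a) + ε := h2
      _ ≤ (∑' a, μ a * ∑' b, ν a b) + ε' + ε := by gcongr
      _ = _ := by rw [add_assoc, add_comm ε']
  · calc ∑' b, (∑' a, μ a * ν a b) * ENNReal.ofReal (Real.exp (inner ℝ (D' b) u))
        = ∑' a, μ a * ENNReal.ofReal (Real.exp (inner ℝ (D a) u)) *
            ∑' b, ν a b * ENNReal.ofReal (Real.exp (inner ℝ (D' b - D a) u)) := by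
          simp_rw [← ENNReal.tsum_mul_right, ← ENNReal.tsum_mul_left]
          rw [ENNReal.tsum_comm]
          refine tsum_congr fun a => tsum_congr fun b => ?_
          rw [inner_sub_left, Real.exp_sub, ENNReal.ofReal_div_of_pos (Real.exp_pos _)]
          have h0 : ENNReal.ofReal (Real.exp (inner ℝ (D a) u)) ≠ 0 := by
            simp [Real.exp_pos]
          rw [mul_mul_mul_comm, ENNReal.mul_div_cancel h0 ENNReal.ofReal_ne_top]
      _ ≤ ∑' a, μ a * ENNReal.ofReal (Real.exp (inner ℝ (D a) u)) *
            ENNReal.ofReal (Real.exp (V' * ‖u‖ ^ 2 / 2)) := by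
          refine ENNReal.tsum_le_tsum fun a => ?_
          by_cases ha : a ∈ p.support
          · gcongr
            exact (hν a ha).2.2 u
          · simp [hzero a ha]
      _ ≤ ENNReal.ofReal (Real.exp (V * ‖u‖ ^ 2 / 2)) *
            ENNReal.ofReal (Real.exp (V' * ‖u‖ ^ 2 / 2)) := by
          rw [ENNReal.tsum_mul_right]
          gcongr
          exact h3 u
      _ = _ := by
          rw [← ENNReal.ofReal_mul (Real.exp_pos _).le, ← Real.exp_add]
          ring_nf

/-- The two-sided Chernoff bound, for a threshold `t` and a multiplier `c`. -/
theorem WeightedSubGaussian.tsum_lt_abs_inner_le {μ : α → ℝ≥0∞} {D : α → H} {V : ℝ}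
    (h : WeightedSubGaussian μ D V) (u : H) (c t : ℝ) (hc : 0 ≤ c) :
    ∑' a, {a | t < |inner ℝ (D a) u|}.indicator μ a ≤
      ENNReal.ofReal (2 * Real.exp (V * (c * ‖u‖) ^ 2 / 2 - c * t)) := by
  have hpos := h (c • u)
  have hneg := h (-(c • u))
  rw [norm_neg, norm_smul, Real.norm_of_nonneg hc] at hneg
  rw [norm_smul, Real.norm_of_nonneg hc] at hpos
  calc ∑' a, {a | t < |inner ℝ (D a) u|}.indicator μ a
      ≤ ∑' a, (μ a * ENNReal.ofReal (Real.exp (inner ℝ (D a) (c • u))) +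
          μ a * ENNReal.ofReal (Real.exp (inner ℝ (D a) (-(c • u))))) *
            ENNReal.ofReal (Real.exp (-(c * t))) := by
        refine ENNReal.tsum_le_tsum fun a => ?_
        by_cases ha : a ∈ {a | t < |inner ℝ (D a) u|}
        swap
        · simp [Set.indicator_of_notMem ha]
        rw [Set.indicator_of_mem ha]
        rw [← mul_add, mul_assoc]
        refine le_mul_of_one_le_right' ?_
        rw [← ENNReal.ofReal_add (Real.exp_pos _).le (Real.exp_pos _).le,
          ← ENNReal.ofReal_mul (by positivity), ENNReal.one_le_ofReal, add_mul, ← Real.exp_add,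
          ← Real.exp_add, inner_neg_right, inner_smul_right]
        rcases lt_abs.1 (show t < |inner ℝ (D a) u| from ha) with ht | ht
        · have := Real.one_le_exp (x := c * inner ℝ (D a) u + -(c * t)) (by nlinarith)
          linarith [Real.exp_pos (-(c * inner ℝ (D a) u) + -(c * t))]
        · have := Real.one_le_exp (x := -(c * inner ℝ (D a) u) + -(c * t)) (by nlinarith)
          linarith [Real.exp_pos (c * inner ℝ (D a) u + -(c * t))]
    _ ≤ (ENNReal.ofReal (Real.exp (V * (c * ‖u‖) ^ 2 / 2)) +
          ENNReal.ofReal (Real.exp (V * (c * ‖u‖) ^ 2 / 2))) *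
            ENNReal.ofReal (Real.exp (-(c * t))) := by
        rw [ENNReal.tsum_mul_right, ENNReal.tsum_add]
        gcongr
    _ = _ := by
        rw [← ENNReal.ofReal_add (Real.exp_pos _).le (Real.exp_pos _).le,
          ← ENNReal.ofReal_mul (by positivity), ← two_mul, mul_assoc, ← Real.exp_add,
          sub_eq_add_neg]

end Pmf

section

/-! ### Kernel halving is sub-Gaussian -/

open ProbabilityTheory MeasureTheory in
/-- Hoeffding's lemma for a random sign. -/
theorem random_sign_exp_le {p : ℝ} (hp0 : 0 ≤ p) (hp1 : p ≤ 1) (y : ℝ) :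
    p * Real.exp y + (1 - p) * Real.exp (-y) ≤ Real.exp ((2 * p - 1) * y + y ^ 2 / 2) := by
  have hp' : ENNReal.ofReal p ≤ 1 := by simpa using hp1
  let P : PMF Bool := PMF.ofFintype (fun b => cond b (ENNReal.ofReal p) (1 - ENNReal.ofReal p))
    (by simp [hp'])
  have hPt : (P true).toReal = p := by simp [P, hp0]
  have hPf : (P false).toReal = 1 - p := by
    simp [P, ENNReal.toReal_sub_of_le hp', hp0]
  let X : Bool → ℝ := fun b => cond b 1 (-1)
  have h := (hasSubgaussianMGF_of_mem_Icc (μ := P.toMeasure) (X := X) (a := -1) (b := 1)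
    (measurable_of_finite _).aemeasurable
    (Filter.Eventually.of_forall fun b => by cases b <;> simp [X])).mgf_le y
  have hmean : ∫ b, X b ∂P.toMeasure = 2 * p - 1 := by
    rw [PMF.integral_eq_sum]
    simp only [Fintype.sum_bool, hPt, hPf, X, smul_eq_mul, cond_true, cond_false]
    ring
  rw [hmean, mgf, PMF.integral_eq_sum] at h
  have hc : (((‖(1:ℝ) - -1‖₊ / 2) ^ 2 : ℝ≥0) : ℝ) = 1 := by norm_num
  rw [hc] at h
  simp only [Fintype.sum_bool, hPt, hPf, X, smul_eq_mul, cond_true, cond_false, one_mul] at h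
  calc p * Real.exp y + (1 - p) * Real.exp (-y)
      = Real.exp ((2 * p - 1) * y) * (p * Real.exp (y * (1 - (2 * p - 1))) +
        (1 - p) * Real.exp (y * (-1 - (2 * p - 1)))) := by
        rw [mul_add, mul_left_comm, mul_left_comm (Real.exp _) (1 - p), ← Real.exp_add,
          ← Real.exp_add]
        ring_nf
    _ ≤ Real.exp ((2 * p - 1) * y) * Real.exp (y ^ 2 / 2) := by gcongr
    _ = _ := by rw [← Real.exp_add]

/-- For `|β| ≤ 1` the clipping of the coin is inactive, so the random sign has mean exactly `-β`,
and Hoeffding's lemma supplies the quadratic term. -/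
theorem tsum_coin_mul_exp_le {β : ℝ} (hβ : |β| ≤ 1) (y : ℝ) :
    ∑' b, coin (1 / 2 * max 0 (1 - β)) b * ENNReal.ofReal (Real.exp (cond b y (-y))) ≤
      ENNReal.ofReal (Real.exp (-β * y + y ^ 2 / 2)) := by
  obtain ⟨h1, h2⟩ := abs_le.1 hβ
  have hmax : max 0 (1 - β) = 1 - β := max_eq_right (by linarith)
  set p : ℝ := 1 / 2 * (1 - β) with hp
  have hp0 : 0 ≤ p := by rw [hp]; linarith
  have hp1 : p ≤ 1 := by rw [hp]; linarith
  have hmin : min 1 (ENNReal.ofReal p) = ENNReal.ofReal p := min_eq_right (by simpa using hp1)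
  rw [tsum_bool, hmax, ← hp]
  simp only [coin, PMF.ofFintype_apply, cond_true, cond_false, hmin]
  rw [← ENNReal.ofReal_one, ← ENNReal.ofReal_sub _ hp0, ← ENNReal.ofReal_mul hp0,
    ← ENNReal.ofReal_mul (by linarith), ← ENNReal.ofReal_add (by positivity)
      (mul_nonneg (by linarith) (Real.exp_pos _).le)]
  refine ENNReal.ofReal_le_ofReal ?_
  have := random_sign_exp_le hp0 hp1 y
  have h3 : 2 * p - 1 = -β := by rw [hp]; ring
  rw [h3] at this
  linarith

variable {X H : Type*} [NormedAddCommGroup H] [InnerProductSpace ℝ H]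

/-- The sum of the features over the discarded points minus the sum over the coreset `S₁`. -/
def imbalance (Φ : X → H) (seen S₁ : List X) : H :=
  (seen.map Φ).sum - (2 : ℝ) • (S₁.map Φ).sum

theorem inner_list_sum_left (Φ : X → H) (S : List X) (f : H) :
    inner ℝ (S.map Φ).sum f = (S.map fun z => inner ℝ (Φ z) f).sum := by
  induction S with
  | nil => simp
  | cons a S ih => simp [inner_add_left, ih]

theorem inner_imbalance (Φ : X → H) (seen S₁ : List X) (f : H) :
    inner ℝ (imbalance Φ seen S₁) f = (seen.map fun z => inner ℝ (Φ z) f).sum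
      - 2 * (S₁.map fun z => inner ℝ (Φ z) f).sum := by
  simp [imbalance, inner_sub_left, inner_smul_left, inner_list_sum_left]

theorem imbalance_append (Φ : X → H) (seen S₁ : List X) (x x' : X) (swap : Bool) :
    imbalance Φ (seen ++ [x, x']) (S₁ ++ [if swap then x' else x]) =
      imbalance Φ seen S₁ + cond swap (Φ x - Φ x') (-(Φ x - Φ x')) := by
  cases swap <;> simp [imbalance] <;> module

/-- One round of the self-balancing walk replaces the test vector `u` by one of smaller norm, which
pays for the randomness of the round. -/
theorem balanced_norm_sq_le {f u : H} {B τ L : ℝ} (hL : 0 < L) (hτ : τ = 1 / 2 + L)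
    (hB : ‖f‖ ≤ B) :
    B ^ 2 * (τ ^ 2 / (2 * L)) *
        ‖u - (inner ℝ f u / (‖f‖ * B * τ)) • f‖ ^ 2 + inner ℝ f u ^ 2 ≤
      B ^ 2 * (τ ^ 2 / (2 * L)) * ‖u‖ ^ 2 := by
  rcases eq_or_ne f 0 with rfl | hf
  · simp
  have hb : 0 < ‖f‖ := norm_pos_iff.2 hf
  have hB0 : 0 < B := hb.trans_le hB
  have hτ0 : 0 < τ := by linarith
  rw [norm_sub_sq_real, norm_smul, mul_pow, inner_smul_right, real_inner_comm f u,
    Real.norm_eq_abs, sq_abs]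
  set b := ‖f‖
  set t : ℝ := inner ℝ f u
  have h1 : B ^ 2 * (τ ^ 2 / (2 * L)) * (‖u‖ ^ 2 - 2 * (t / (b * B * τ) * t) +
      (t / (b * B * τ)) ^ 2 * b ^ 2) + t ^ 2 =
      B ^ 2 * (τ ^ 2 / (2 * L)) * ‖u‖ ^ 2
        - t ^ 2 / (2 * L * b) * (B * (2 * τ) - b - 2 * L * b) := by
    field_simp
    ring
  rw [h1, sub_le_self_iff]
  refine mul_nonneg (by positivity) ?_
  have : b * (1 + 2 * L) ≤ B * (1 + 2 * L) := by gcongr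
  rw [hτ]
  linarith

/-- One round of kernel halving, started from weights under which the imbalance is sub-Gaussian. -/
theorem khRound_weightedSubGaussian {Φ : X → H} {L τ : ℝ} (hL : 0 < L) (hτ : τ = 1 / 2 + L)
    (seen : List X) (x x' : X) {b B : ℝ} (hb : 0 ≤ b) (hB : B = max ‖Φ x - Φ x'‖ b)
    (p : List X → PMF Bool)
    (hp : ∀ S₁, p S₁ = coin (1 / 2 * max 0
      (1 - inner ℝ (imbalance Φ seen S₁) (Φ x - Φ x') / (‖Φ x - Φ x'‖ * B * τ))))
    (μ : List X → ℝ≥0∞)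
    (hμ : WeightedSubGaussian μ (imbalance Φ seen) (b ^ 2 * (τ ^ 2 / (2 * L)))) :
    ∃ μ' : List X → ℝ≥0∞,
      (∀ S, μ' S ≤ ∑' S₁, μ S₁ *
        (p S₁).map (fun swap => S₁ ++ [if swap then x' else x]) S) ∧
      (∑' S, μ S) ≤ (∑' S, μ' S) + ENNReal.ofReal (2 * Real.exp (-L)) ∧
      WeightedSubGaussian μ' (imbalance Φ (seen ++ [x, x'])) (B ^ 2 * (τ ^ 2 / (2 * L))) := by
  classical
  set f := Φ x - Φ x' with hf
  set a : ℝ := ‖f‖ * B * τ with ha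
  have hfB : ‖f‖ ≤ B := hB ▸ le_max_left _ _
  have hbB : b ≤ B := hB ▸ le_max_right _ _
  have hτ0 : 0 < τ := by linarith
  have hB0 : 0 ≤ B := hb.trans hbB
  have hμ' : WeightedSubGaussian μ (imbalance Φ seen) (B ^ 2 * (τ ^ 2 / (2 * L))) :=
    hμ.mono (by gcongr)
  set bad : Set (List X) := {S₁ | a < |inner ℝ (imbalance Φ seen S₁) f|} with hbad
  have hfail : ∑' S₁, bad.indicator μ S₁ ≤ ENNReal.ofReal (2 * Real.exp (-L)) := by
    -- For `f = 0` the threshold `a` is zero, but the strict inequality defining `bad` still fails,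
    -- so nothing is discarded.
    rcases eq_or_ne f 0 with hf0 | hf0
    · have : bad = ∅ := by simp [hbad, ha, hf0]
      simp [this]
    have hfpos : 0 < ‖f‖ := norm_pos_iff.2 hf0
    have hBpos : 0 < B := hfpos.trans_le hfB
    -- `2L/a` is the optimal Chernoff multiplier for threshold `a = ‖f‖Bτ` and proxy `B²τ²/(2L)`;
    -- the resulting exponent is exactly `-L`.
    refine (hμ'.tsum_lt_abs_inner_le f (2 * L / a) a (by positivity)).trans (le_of_eq ?_)
    congr 3
    rw [ha]
    field_simp
    ring
  refine ⟨fun S => ∑' S₁, badᶜ.indicator μ S₁ *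
        (p S₁).map (fun swap => S₁ ++ [if swap then x' else x]) S, fun S => ?_, ?_, fun u => ?_⟩
  · exact ENNReal.tsum_le_tsum fun S₁ => by
      gcongr
      exact Set.indicator_le_self _ _ _
  · rw [ENNReal.tsum_comm]
    simp_rw [ENNReal.tsum_mul_left, PMF.tsum_coe, mul_one]
    refine le_trans (le_of_eq ?_) (add_le_add_right hfail _)
    rw [← ENNReal.tsum_add]
    exact tsum_congr fun S₁ => by
      have := congrFun (Set.indicator_self_add_compl bad μ) S₁
      rw [← this, Pi.add_apply, add_comm]
  -- Off `bad` the sign has mean `-α/a`. As `α` is linear in the imbalance, this drift turns the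
  -- test vector `u` into `u'`, leaving only the noise `⟨f, u⟩²/2`.
  · set u' := u - (inner ℝ f u / a) • f with hu'
    have hmain : ∀ S₁, badᶜ.indicator μ S₁ *
        ∑' S, (p S₁).map (fun swap => S₁ ++ [if swap then x' else x]) S *
          ENNReal.ofReal (Real.exp (inner ℝ (imbalance Φ (seen ++ [x, x']) S) u)) ≤
        μ S₁ * ENNReal.ofReal (Real.exp (inner ℝ (imbalance Φ seen S₁) u')) *
          ENNReal.ofReal (Real.exp (inner ℝ f u ^ 2 / 2)) := by
      intro S₁
      by_cases hS : S₁ ∈ bad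
      · simp [hS]
      rw [Set.indicator_of_mem (show S₁ ∈ badᶜ from hS), mul_assoc]
      gcongr
      set α : ℝ := inner ℝ (imbalance Φ seen S₁) f with hα
      have hle : |α / a| ≤ 1 := by
        have : |α| ≤ a := not_lt.1 hS
        rw [abs_div]
        exact div_le_one_of_le₀ (this.trans (le_abs_self a)) (abs_nonneg _)
      rw [tsum_pmf_map_mul, hp]
      calc ∑' swap, coin (1 / 2 * max 0 (1 - α / a)) swap * ENNReal.ofReal (Real.exp
            (inner ℝ (imbalance Φ (seen ++ [x, x']) (S₁ ++ [if swap then x' else x])) u))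
          = ENNReal.ofReal (Real.exp (inner ℝ (imbalance Φ seen S₁) u)) *
            ∑' swap, coin (1 / 2 * max 0 (1 - α / a)) swap *
              ENNReal.ofReal (Real.exp (cond swap (inner ℝ f u) (-(inner ℝ f u)))) := by
            rw [← ENNReal.tsum_mul_left]
            refine tsum_congr fun swap => ?_
            rw [imbalance_append, inner_add_left, Real.exp_add,
              ENNReal.ofReal_mul (Real.exp_pos _).le, mul_left_comm]
            cases swap <;> simp [← hf, inner_neg_left]
        _ ≤ ENNReal.ofReal (Real.exp (inner ℝ (imbalance Φ seen S₁) u)) *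
            ENNReal.ofReal (Real.exp (-(α / a) * inner ℝ f u + inner ℝ f u ^ 2 / 2)) := by
            gcongr
            exact tsum_coin_mul_exp_le hle _
        _ = _ := by
            rw [← ENNReal.ofReal_mul (Real.exp_pos _).le,
              ← ENNReal.ofReal_mul (Real.exp_pos _).le, ← Real.exp_add, ← Real.exp_add, hu',
              inner_sub_right, inner_smul_right, ← hα]
            congr 2
            ring
    calc ∑' S, (∑' S₁, badᶜ.indicator μ S₁ *
            (p S₁).map (fun swap => S₁ ++ [if swap then x' else x]) S) *
            ENNReal.ofReal (Real.exp (inner ℝ (imbalance Φ (seen ++ [x, x']) S) u))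
        = ∑' S₁, badᶜ.indicator μ S₁ *
            ∑' S, (p S₁).map (fun swap => S₁ ++ [if swap then x' else x]) S *
            ENNReal.ofReal (Real.exp (inner ℝ (imbalance Φ (seen ++ [x, x']) S) u)) := by
          simp_rw [← ENNReal.tsum_mul_right, ← ENNReal.tsum_mul_left]
          rw [ENNReal.tsum_comm]
          simp_rw [mul_assoc]
      _ ≤ ∑' S₁, μ S₁ * ENNReal.ofReal (Real.exp (inner ℝ (imbalance Φ seen S₁) u')) *
            ENNReal.ofReal (Real.exp (inner ℝ f u ^ 2 / 2)) := ENNReal.tsum_le_tsum hmain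
      _ ≤ ENNReal.ofReal (Real.exp (B ^ 2 * (τ ^ 2 / (2 * L)) * ‖u'‖ ^ 2 / 2)) *
            ENNReal.ofReal (Real.exp (inner ℝ f u ^ 2 / 2)) := by
          rw [ENNReal.tsum_mul_right]
          gcongr
          exact hμ' u'
      _ ≤ _ := by
          rw [← ENNReal.ofReal_mul (Real.exp_pos _).le, ← Real.exp_add]
          refine ENNReal.ofReal_le_ofReal (Real.exp_le_exp.2 ?_)
          have := balanced_norm_sq_le (u := u) hL hτ hfB
          rw [← ha, ← hu'] at this
          linarith

/-- The induction carries weights on the possible coresets, since the event discarded in a round is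
estimated from the law of the current imbalance. The running maximum `b` depends only on the input
pairs and not on the coins, so a single value of `b` serves all coresets. Each round costs `2 exp
(-L)`, that is `exp (-L)` per input point. -/
theorem khLoop_weightedSubGaussian {κ : X → X → ℝ} {Φ : X → H}
    (hκ : ∀ x y, κ x y = inner ℝ (Φ x) (Φ y)) {L τ : ℝ} (hL : 0 < L) (hτ : τ = 1 / 2 + L) {B : ℝ}
    (hΦ : ∀ x x', ‖Φ x - Φ x'‖ ≤ B) :
    ∀ (rest seen : List X) (b : ℝ) (μ : List X → ℝ≥0∞), Even rest.length → 0 ≤ b → b ≤ B →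
      WeightedSubGaussian μ (imbalance Φ seen) (b ^ 2 * (τ ^ 2 / (2 * L))) →
      ∃ μ' : List X → ℝ≥0∞,
        (∀ T, μ' T ≤ ∑' S, μ S * khLoop κ τ seen S b rest T) ∧
        (∑' S, μ S) ≤ (∑' S, μ' S) + ENNReal.ofReal (rest.length * Real.exp (-L)) ∧
        WeightedSubGaussian μ' (imbalance Φ (seen ++ rest)) (B ^ 2 * (τ ^ 2 / (2 * L)))
  | [], seen, b, μ, _, hb, hbB, hμ => by
    refine ⟨μ, fun T => ?_, by simp, ?_⟩
    · rw [tsum_eq_single T]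
      · simp [khLoop]
      · intro S hS
        simp [khLoop, PMF.pure_apply, hS.symm]
    · rw [List.append_nil]
      exact hμ.mono (by gcongr)
  | [x], _, _, _, h, _, _, _ => by simp at h
  | x :: x' :: rest, seen, b, μ, h, hb, hbB, hμ => by
    have hrest : Even rest.length := by
      simpa [Nat.even_add_one] using h
    have hnorm : √(κ x x + κ x' x' - 2 * κ x x') = ‖Φ x - Φ x'‖ := by
      rw [hκ, hκ, hκ, ← Real.sqrt_sq (norm_nonneg (Φ x - Φ x')), norm_sub_sq_real,
        real_inner_self_eq_norm_sq, real_inner_self_eq_norm_sq]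
      ring_nf
    have hstep : ∀ S, khLoop κ τ seen S b (x :: x' :: rest) =
        ((coin (1 / 2 * max 0 (1 - inner ℝ (imbalance Φ seen S) (Φ x - Φ x') /
          (‖Φ x - Φ x'‖ * max ‖Φ x - Φ x'‖ b * τ)))).map
            fun swap => S ++ [if swap then x' else x]).bind fun S' =>
          khLoop κ τ (seen ++ [x, x']) S' (max ‖Φ x - Φ x'‖ b) rest := by
      intro S
      rw [khLoop, PMF.bind_map, inner_imbalance, hnorm]
      simp only [hκ, inner_sub_right]
      rfl
    obtain ⟨μ₁, h1, h2, h3⟩ := khRound_weightedSubGaussian hL hτ seen x x' hb rfl _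
      (fun _ => rfl) μ hμ
    obtain ⟨μ₂, h4, h5, h6⟩ := khLoop_weightedSubGaussian hκ hL hτ hΦ rest (seen ++ [x, x']) _ μ₁
      hrest (hb.trans (le_max_right _ _)) (max_le (hΦ x x') hbB) h3
    refine ⟨μ₂, fun T => ?_, ?_, by simpa using h6⟩
    · calc μ₂ T ≤ ∑' S', μ₁ S' * khLoop κ τ (seen ++ [x, x']) S' (max ‖Φ x - Φ x'‖ b) rest T := h4 T
        _ ≤ ∑' S', (∑' S, μ S * _) *
            khLoop κ τ (seen ++ [x, x']) S' (max ‖Φ x - Φ x'‖ b) rest T := by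
          gcongr with S'
          exact h1 S'
        _ = _ := by
          simp_rw [hstep, PMF.bind_apply, ← ENNReal.tsum_mul_right, ← ENNReal.tsum_mul_left]
          rw [ENNReal.tsum_comm]
          simp_rw [mul_assoc]
    · calc (∑' S, μ S) ≤ (∑' S, μ₁ S) + ENNReal.ofReal (2 * Real.exp (-L)) := h2
        _ ≤ (∑' S, μ₂ S) + ENNReal.ofReal (rest.length * Real.exp (-L)) +
            ENNReal.ofReal (2 * Real.exp (-L)) := by gcongr
        _ = _ := by
          rw [add_assoc, ← ENNReal.ofReal_add (by positivity) (by positivity)]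
          congr 2
          push_cast [List.length_cons]
          ring

/-- With `N` points the loop discards at most `N exp (-L)`, and `L = log (2N/δ)` makes this `δ/2`.
-/
theorem kernelHalving_subGaussianOff {κ : X → X → ℝ} {Φ : X → H}
    (hκ : ∀ x y, κ x y = inner ℝ (Φ x) (Φ y)) {B : ℝ} (hB : 0 ≤ B)
    (hΦ : ∀ x x', ‖Φ x - Φ x'‖ ≤ B) {S : List X} (hS : Even S.length) {δ L : ℝ} (hδ : 0 < δ)
    (hL : L = Real.log (2 * S.length / δ)) (hL0 : 0 < L) :
    SubGaussianOff (kernelHalving κ δ S) (imbalance Φ S) (B ^ 2 * ((1 / 2 + L) ^ 2 / (2 * L)))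
      (ENNReal.ofReal (δ / 2)) := by
  classical
  have hlen : (S.length : ℝ) ≠ 0 := by
    intro h
    rw [h] at hL
    simp [hL] at hL0
  obtain ⟨μ, h1, h2, h3⟩ := khLoop_weightedSubGaussian hκ hL0 (τ := 1 / 2 + L) rfl hΦ S [] 0
    (PMF.pure []) hS le_rfl hB (fun u => by
      rw [tsum_pmf_pure_mul]
      simp [imbalance])
  refine ⟨μ, fun T => ?_, ?_, by simpa using h3⟩
  · refine (h1 T).trans (le_of_eq ?_)
    rw [tsum_pmf_pure_mul (F := fun S' => khLoop κ (1 / 2 + L) [] S' 0 S T), kernelHalving, hL]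
  · rw [PMF.tsum_coe] at h2
    refine h2.trans (le_of_eq ?_)
    congr 2
    have : (0:ℝ) < S.length := by positivity
    rw [Real.exp_neg, hL, Real.exp_log (by positivity)]
    field_simp

theorem length_of_mem_support_khLoop (κ : X → X → ℝ) (τ : ℝ) :
    ∀ (rest seen S : List X) (b : ℝ), ∀ T ∈ (khLoop κ τ seen S b rest).support,
      T.length = S.length + rest.length / 2
  | [], _, _, _, T, hT => by simp_all [khLoop]
  | [_], _, _, _, T, hT => by simp_all [khLoop]
  | x :: x' :: rest, seen, S, b, T, hT => by
    rw [khLoop] at hT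
    simp only [PMF.mem_support_bind_iff] at hT
    obtain ⟨swap, -, h⟩ := hT
    rw [length_of_mem_support_khLoop κ τ rest _ _ _ T h]
    simp
    omega

theorem length_of_mem_support_kernelHalving {κ : X → X → ℝ} {δ : ℝ} {S T : List X}
    (hT : T ∈ (kernelHalving κ δ S).support) : T.length = S.length / 2 := by
  simpa using length_of_mem_support_khLoop _ _ _ _ _ _ T hT

end

section

/-! ### Recursive compression is sub-Gaussian -/

variable {X H : Type*} [NormedAddCommGroup H] [InnerProductSpace ℝ H]

/-- The parameter at which kernel halving is called by `compress` on a sequence of length `s`. -/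
def halvingLevel (nin g : ℕ) (δ s : ℝ) : ℝ :=
  (2 * 2 ^ g * √s) ^ 2 / ((nin : ℝ) * 4 ^ (g + 1) * (Real.logb 4 (nin : ℝ) - (g : ℝ))) * δ

theorem compress_succ (P : QuarteringRule X) (κ : X → X → ℝ) (δ : ℝ) (nin g r : ℕ) (S : List X) :
    compress P κ δ nin g (r + 1) S =
      (compress P κ δ nin g r (P.part S 0)).bind fun S₀ =>
      (compress P κ δ nin g r (P.part S 1)).bind fun S₁ =>
      (compress P κ δ nin g r (P.part S 2)).bind fun S₂ =>
      (compress P κ δ nin g r (P.part S 3)).bind fun S₃ =>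
        kernelHalving κ (halvingLevel nin g δ S.length) (S₀ ++ S₁ ++ S₂ ++ S₃) := rfl

theorem four_dvd_length {g r : ℕ} {S : List X} (hS : S.length = 4 ^ (g + (r + 1))) :
    4 ∣ S.length := by
  rw [hS, ← add_assoc, pow_succ]
  exact dvd_mul_left _ _

theorem length_part_eq (P : QuarteringRule X) {g r : ℕ} {S : List X}
    (hS : S.length = 4 ^ (g + (r + 1))) (i : Fin 4) : (P.part S i).length = 4 ^ (g + r) := by
  rw [P.length_part S (four_dvd_length hS), hS, ← add_assoc, pow_succ]
  simp

theorem length_of_mem_support_compress (P : QuarteringRule X) (κ : X → X → ℝ) (δ : ℝ)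
    (nin g : ℕ) : ∀ (r : ℕ) (S : List X), S.length = 4 ^ (g + r) →
      ∀ T ∈ (compress P κ δ nin g r S).support, T.length = 2 ^ (2 * g + r)
  | 0, S, hS, T, hT => by
    simp only [compress, PMF.support_pure, Set.mem_singleton_iff] at hT
    rw [hT, hS, add_zero, add_zero, pow_mul]
    norm_num
  | r + 1, S, hS, T, hT => by
    rw [compress_succ] at hT
    simp only [PMF.mem_support_bind_iff] at hT
    obtain ⟨S₀, h0, S₁, h1, S₂, h2, S₃, h3, hT⟩ := hT
    have ih := fun i => length_of_mem_support_compress P κ δ nin g r (P.part S i)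
      (length_part_eq P hS i)
    rw [length_of_mem_support_kernelHalving hT]
    simp only [List.length_append, ih _ _ h0, ih _ _ h1, ih _ _ h2, ih _ _ h3]
    rw [← add_assoc, pow_succ]
    omega

/-- There are `4^m / 4^(r+1)` halving calls on sequences of this length, so each of the `m` levels
receives `1/(2m)` of the failure budget, in total `1/2`. -/
theorem halvingLevel_eq {g m : ℕ} (hm : 0 < m) (r : ℕ) :
    halvingLevel (4 ^ (g + m)) g (1 / 2) ((4 ^ (g + (r + 1)) : ℕ) : ℝ) =
      4 ^ (r + 1) / 4 ^ m / (2 * m) := by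
  have hm' : (m : ℝ) ≠ 0 := by positivity
  have hlog : Real.logb 4 (((4 ^ (g + m) : ℕ) : ℝ)) = g + m := by
    push_cast
    rw [Real.logb_pow, Real.logb_self_eq_one (by norm_num)]
    push_cast
    ring
  have h2 : ((2:ℝ) ^ g) ^ 2 = 4 ^ g := by rw [← pow_mul, mul_comm, pow_mul]; norm_num
  rw [halvingLevel, hlog, add_sub_cancel_left, mul_pow, mul_pow, Real.sq_sqrt (by positivity), h2]
  push_cast
  field_simp
  ring

theorem half_add_sq_div_le {x : ℝ} (hx : 2 ≤ x) : (1 / 2 + x) ^ 2 / (2 * x) ≤ x := by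
  rw [div_le_iff₀ (by linarith)]
  nlinarith

/-- The argument of the logarithm equals `4m · 2^(2g) · 2^m · 2^(m-r)`. It is at least `8 > e²`, as
`half_add_sq_div_le` requires, and at most the square of `8 · 2^(2g+m) · m`, which gives one bound
for all levels. -/
theorem compress_log_bounds {g m r : ℕ} (hr : r < m) :
    2 ≤ Real.log (2 * (4 * 2 ^ (2 * g + r)) / ((4:ℝ) ^ (r + 1) / 4 ^ m / (2 * m))) ∧
    Real.log (2 * (4 * 2 ^ (2 * g + r)) / ((4:ℝ) ^ (r + 1) / 4 ^ m / (2 * m))) ≤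
      2 * Real.log (8 * 2 ^ (2 * g + m) * m) := by
  have hm : 1 ≤ m := by omega
  have hmR : (1:ℝ) ≤ m := by exact_mod_cast hm
  have h4 : ∀ k : ℕ, (4:ℝ) ^ k = 2 ^ k * 2 ^ k := fun k => by rw [← mul_pow]; norm_num
  have hx : 2 * (4 * 2 ^ (2 * g + r)) / ((4:ℝ) ^ (r + 1) / 4 ^ m / (2 * m)) =
      4 * m * 2 ^ (2 * g) * 2 ^ m * (2 ^ (m - r)) := by
    have : (2:ℝ) ^ m = 2 ^ (m - r) * 2 ^ r := by rw [← pow_add]; congr 1; omega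
    rw [pow_succ, h4, h4, pow_add]
    field_simp
    rw [this]
    ring
  rw [hx]
  have hg1 : (1:ℝ) ≤ 2 ^ (2 * g) := one_le_pow₀ (by norm_num)
  have hm2 : (2:ℝ) ≤ 2 ^ m := by
    calc (2:ℝ) = 2 ^ 1 := by norm_num
      _ ≤ 2 ^ m := pow_le_pow_right₀ (by norm_num) hm
  have hr1 : (1:ℝ) ≤ 2 ^ (m - r) := one_le_pow₀ (by norm_num)
  constructor
  · rw [Real.le_log_iff_exp_le (by positivity)]
    have he : Real.exp 2 ≤ 8 := by
      have := Real.exp_one_lt_d9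
      rw [show (2:ℝ) = 1 + 1 by norm_num, Real.exp_add]
      nlinarith [Real.exp_pos 1]
    calc Real.exp 2 ≤ 4 * 1 * 1 * 2 * 1 := by linarith
      _ ≤ 4 * m * 2 ^ (2 * g) * 2 ^ m * (2 ^ (m - r)) := by gcongr
  · rw [← Real.log_rpow (by positivity)]
    refine Real.log_le_log (by positivity) ?_
    rw [Real.rpow_ofNat, mul_pow, mul_pow, pow_add]
    calc (4:ℝ) * m * 2 ^ (2 * g) * 2 ^ m * (2 ^ (m - r))
        ≤ 8 ^ 2 * (m * m) * (2 ^ (2 * g) * 2 ^ (2 * g)) * 2 ^ m * 2 ^ m := by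
          gcongr
          · norm_num
          · nlinarith
          · nlinarith
          · norm_num
          · omega
      _ = _ := by ring

/-- The error at level `r + 1` is the sum of the four errors at level `r` plus `2^r` times the
imbalance of the halving call. Hence `V_{r+1} = 4 V_r + 8 · 4^r K L`, and the discarded mass obeys a
recursion of the same shape; the stated formulas solve both. -/
theorem compress_subGaussianOff {κ : X → X → ℝ} {Φ : X → H}
    (hκ : ∀ x y, κ x y = inner ℝ (Φ x) (Φ y)) {K : ℝ} (hK : ∀ x, ‖Φ x‖ ^ 2 ≤ K)
    (P : QuarteringRule X) {g m : ℕ} (hm : 0 < m) (hK0 : 0 ≤ K) :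
    ∀ (r : ℕ) (S : List X), r ≤ m → S.length = 4 ^ (g + r) →
      SubGaussianOff (compress P κ (1 / 2) (4 ^ (g + m)) g r S)
        (fun T => (S.map Φ).sum - (2:ℝ) ^ r • (T.map Φ).sum)
        (2 * r * 4 ^ r * K * Real.log (8 * 2 ^ (2 * g + m) * m))
        (ENNReal.ofReal (r * 4 ^ r / 4 ^ m / (4 * m)))
  | 0, S, _, _ => by
    have := SubGaussianOff.pure S (D := fun T => (S.map Φ).sum - (2:ℝ) ^ 0 • (T.map Φ).sum)
      (by simp)
    simpa [compress] using this
  | r + 1, S, hr, hS => by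
    have ih := fun i => compress_subGaussianOff hκ hK P (g := g) hm hK0 r (P.part S i) (by omega)
      (length_part_eq P hS i)
    have hlen := fun i => length_of_mem_support_compress P κ (1 / 2) (4 ^ (g + m)) g r (P.part S i)
      (length_part_eq P hS i)
    obtain ⟨hlog1, hlog2⟩ := compress_log_bounds (g := g) (m := m) (r := r) hr
    set L := Real.log (8 * 2 ^ (2 * g + m) * m) with hL
    set L' := Real.log (2 * (4 * 2 ^ (2 * g + r)) / ((4:ℝ) ^ (r + 1) / 4 ^ m / (2 * m))) with hL'
    have hmR : (0:ℝ) < m := by exact_mod_cast hm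
    have hsum : (S.map Φ).sum = ((P.part S 0).map Φ).sum + ((P.part S 1).map Φ).sum +
        ((P.part S 2).map Φ).sum + ((P.part S 3).map Φ).sum := by
      rw [← ((P.perm S (four_dvd_length hS)).map Φ).sum_eq]
      simp [add_assoc]
    have hΦ : ∀ x x', ‖Φ x - Φ x'‖ ≤ 2 * √K := fun x x' => by
      have h1 : ∀ y, ‖Φ y‖ ≤ √K := fun y => Real.le_sqrt_of_sq_le (hK y)
      linarith [norm_sub_le (Φ x) (Φ x'), h1 x, h1 x']
    have hhalf : ∀ C : List X, C.length = 4 * 2 ^ (2 * g + r) →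
        SubGaussianOff (kernelHalving κ (halvingLevel (4 ^ (g + m)) g (1 / 2) S.length) C)
          (fun T => (2:ℝ) ^ r • imbalance Φ C T) (8 * 4 ^ r * K * L)
          (ENNReal.ofReal (4 ^ (r + 1) / 4 ^ m / (4 * m))) := by
      intro C hC
      rw [hS, halvingLevel_eq hm]
      have := kernelHalving_subGaussianOff hκ (by positivity) hΦ (S := C)
        (by rw [hC]; exact ⟨2 * 2 ^ (2 * g + r), by ring⟩)
        (δ := (4:ℝ) ^ (r + 1) / 4 ^ m / (2 * m)) (L := L') (by positivity)
        (by rw [hL', hC]; push_cast; rfl) (by linarith)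
      refine (this.smul ((2:ℝ) ^ r)).mono ?_ (ENNReal.ofReal_le_ofReal (le_of_eq ?_))
      · rw [mul_pow, Real.sq_sqrt hK0, ← pow_mul, mul_comm r, pow_mul]
        have h1 := half_add_sq_div_le hlog1
        calc ((2:ℝ) ^ 2) ^ r * (2 ^ 2 * K * ((1 / 2 + L') ^ 2 / (2 * L')))
            ≤ ((2:ℝ) ^ 2) ^ r * (2 ^ 2 * K * (2 * L)) := by
              gcongr
              exact h1.trans hlog2
          _ = _ := by norm_num; ring
      · field_simp
        norm_num
    rw [compress_succ]
    refine SubGaussianOff.mono ((ih 0).bind fun S₀ h0 => (ih 1).bind fun S₁ h1 =>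
      (ih 2).bind fun S₂ h2 => (ih 3).bind
        (V' := 8 * 4 ^ r * K * L) (ε' := ENNReal.ofReal (4 ^ (r + 1) / 4 ^ m / (4 * m)))
        fun S₃ h3 => ?_) ?_ ?_
    · have := hhalf (S₀ ++ S₁ ++ S₂ ++ S₃) (by
        simp only [List.length_append, hlen _ _ h0, hlen _ _ h1, hlen _ _ h2, hlen _ _ h3]
        ring)
      convert this using 2 with T
      simp only [imbalance, List.map_append, List.sum_append, hsum]
      module
    · apply le_of_eq
      push_cast
      ring
    · rw [← ENNReal.ofReal_add (by positivity) (by positivity),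
        ← ENNReal.ofReal_add (by positivity) (by positivity),
        ← ENNReal.ofReal_add (by positivity) (by positivity),
        ← ENNReal.ofReal_add (by positivity) (by positivity)]
      refine ENNReal.ofReal_le_ofReal (le_of_eq ?_)
      push_cast
      ring

end

/-! ### A feature space for the attention kernel -/

/-- Tensors of degree `p` over `ℝ ^ d` with coefficients in `ℝ ^ e`. -/
abbrev TensorSpace (d e p : ℕ) : Type := EuclideanSpace ℝ ((Fin p → Fin d) × Fin e)

/-- The pure tensor `y₁ ⊗ ⋯ ⊗ y_p ⊗ v`. -/
def pureTensor {d e p : ℕ} (y : Fin p → EuclideanSpace ℝ (Fin d)) (v : EuclideanSpace ℝ (Fin e)) :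
    TensorSpace d e p :=
  WithLp.toLp 2 fun t => (∏ i, y i (t.1 i)) * v t.2

theorem inner_pureTensor {d e p : ℕ} (y y' : Fin p → EuclideanSpace ℝ (Fin d))
    (v v' : EuclideanSpace ℝ (Fin e)) :
    inner ℝ (pureTensor y v) (pureTensor y' v') = (∏ i, inner ℝ (y i) (y' i)) * inner ℝ v v' := by
  simp only [PiLp.inner_apply, pureTensor, RCLike.inner_apply, conj_trivial]
  rw [Fintype.sum_prod_type, Finset.prod_univ_sum, Fintype.piFinset_univ, Finset.sum_mul_sum]
  refine Finset.sum_congr rfl fun t _ => Finset.sum_congr rfl fun j _ => ?_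
  rw [Finset.prod_mul_distrib]
  ring

theorem norm_pureTensor {d e p : ℕ} (y : Fin p → EuclideanSpace ℝ (Fin d))
    (v : EuclideanSpace ℝ (Fin e)) : ‖pureTensor y v‖ = (∏ i, ‖y i‖) * ‖v‖ := by
  rw [← sq_eq_sq₀ (norm_nonneg _) (by positivity), ← real_inner_self_eq_norm_sq, inner_pureTensor]
  simp_rw [real_inner_self_eq_norm_sq]
  rw [Finset.prod_pow, mul_pow]

theorem pureTensor_smul {d e p : ℕ} (c : ℝ) (z : EuclideanSpace ℝ (Fin d))
    (v : EuclideanSpace ℝ (Fin e)) :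
    pureTensor (fun _ : Fin p => c • z) v = c ^ p • pureTensor (fun _ : Fin p => z) v := by
  ext t
  simp [pureTensor, Finset.prod_mul_distrib, mul_assoc]

/-- The expansion puts different points into different slots, which is why the later union bound
ranges over tensors with arbitrary grid factors and not only over powers. -/
theorem pureTensor_sum {d e p : ℕ} {ι : Type*} [Fintype ι] (w : ι → ℝ)
    (y : ι → EuclideanSpace ℝ (Fin d)) (v : EuclideanSpace ℝ (Fin e)) :
    pureTensor (fun _ : Fin p => ∑ a, w a • y a) v =
      ∑ c : Fin p → ι, (∏ i, w (c i)) • pureTensor (fun i => y (c i)) v := by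
  classical
  ext t
  simp only [pureTensor, WithLp.ofLp_sum, WithLp.ofLp_smul, Finset.sum_apply, Pi.smul_apply,
    smul_eq_mul]
  rw [Finset.prod_univ_sum, Fintype.piFinset_univ, Finset.sum_mul]
  refine Finset.sum_congr rfl fun c _ => ?_
  rw [Finset.prod_mul_distrib, mul_assoc]

/-- The Hilbert sum of the tensor powers. -/
abbrev FockSpace (d e : ℕ) : Type := lp (fun p : ℕ => TensorSpace d e p) 2

theorem hasSum_norm_coherent {d e : ℕ} (z : EuclideanSpace ℝ (Fin d))
    (v : EuclideanSpace ℝ (Fin e)) :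
    HasSum (fun p : ℕ => ‖(√(p.factorial : ℝ))⁻¹ • pureTensor (fun _ : Fin p => z) v‖ ^ 2)
      (Real.exp (‖z‖ ^ 2) * ‖v‖ ^ 2) := by
  have h := (NormedSpace.expSeries_div_hasSum_exp (𝔸 := ℝ) (‖z‖ ^ 2)).mul_right (‖v‖ ^ 2)
  rw [← Real.exp_eq_exp_ℝ] at h
  refine h.congr_fun fun p => ?_
  rw [norm_smul, norm_pureTensor, Finset.prod_const, Finset.card_univ, Fintype.card_fin,
    Real.norm_of_nonneg (by positivity), mul_pow, inv_pow, Real.sq_sqrt (by positivity), mul_pow,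
    ← pow_mul, ← pow_mul, mul_comm p]
  ring

/-- The coherent vector `∑ z^{⊗ p} ⊗ v / √p!`. -/
def coherent {d e : ℕ} (z : EuclideanSpace ℝ (Fin d)) (v : EuclideanSpace ℝ (Fin e)) :
    FockSpace d e :=
  ⟨fun p => (√(p.factorial : ℝ))⁻¹ • pureTensor (fun _ : Fin p => z) v, by
    refine memℓp_gen ?_
    simpa using (hasSum_norm_coherent z v).summable⟩

theorem coherent_apply {d e : ℕ} (z : EuclideanSpace ℝ (Fin d)) (v : EuclideanSpace ℝ (Fin e))
    (p : ℕ) :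
    coherent z v p = (√(p.factorial : ℝ))⁻¹ • pureTensor (fun _ : Fin p => z) v := rfl

theorem inner_coherent {d e : ℕ} (z z' : EuclideanSpace ℝ (Fin d))
    (v v' : EuclideanSpace ℝ (Fin e)) :
    inner ℝ (coherent z v) (coherent z' v') = Real.exp (inner ℝ z z') * inner ℝ v v' := by
  have h := (NormedSpace.expSeries_div_hasSum_exp (𝔸 := ℝ) (inner ℝ z z')).mul_right (inner ℝ v v')
  rw [← Real.exp_eq_exp_ℝ] at h
  refine (lp.hasSum_inner (𝕜 := ℝ) (coherent z v) (coherent z' v')).unique ?_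
  refine h.congr_fun fun p => ?_
  rw [coherent_apply, coherent_apply, inner_smul_left, inner_smul_right, inner_pureTensor]
  simp only [conj_trivial, Finset.prod_const, Finset.card_univ, Fintype.card_fin]
  rw [← mul_assoc, ← mul_inv, Real.mul_self_sqrt (by positivity)]
  ring

/-! ### Discretization of the unit ball -/

/-- The points of the lattice of mesh `1 / (4 √d)`. -/
def latticePoint {d : ℕ} (M : Fin d → ℤ) : EuclideanSpace ℝ (Fin d) :=
  WithLp.toLp 2 fun i => (M i : ℝ) / (4 * √(d : ℝ))

theorem norm_latticePoint_sq {d : ℕ} (M : Fin d → ℤ) :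
    ‖latticePoint M‖ ^ 2 = (∑ i, (M i : ℝ) ^ 2) / (16 * d) := by
  rw [EuclideanSpace.norm_sq_eq, Finset.sum_div]
  refine Finset.sum_congr rfl fun i _ => ?_
  simp only [latticePoint, Real.norm_eq_abs, sq_abs]
  rw [div_pow, mul_pow, Real.sq_sqrt (by positivity)]
  norm_num

/-- The lattice points in the ball of radius `5 / 4`. -/
def grid (d : ℕ) : Finset (Fin d → ℤ) :=
  open Classical in
  (Fintype.piFinset fun _ => Finset.Icc (-(5 * d : ℤ)) (5 * d)).filter
    fun M => ‖latticePoint M‖ ≤ 5 / 4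

/-- The norm bound says `∑ M_i² ≤ 25 d`, and `|x| ≤ x²/10 + 5/2` turns this into an `ℓ¹` bound. -/
theorem sum_abs_le_of_norm_latticePoint_le {d : ℕ} (hd : 0 < d) {M : Fin d → ℤ}
    (hM : ‖latticePoint M‖ ≤ 5 / 4) : ∑ i, |M i| ≤ 5 * (d : ℤ) := by
  have hd' : (0:ℝ) < d := by exact_mod_cast hd
  have h : ‖latticePoint M‖ ^ 2 ≤ (5 / 4) ^ 2 := by gcongr
  rw [norm_latticePoint_sq, div_le_iff₀ (by positivity)] at h
  have h2 : ∑ i, |(M i : ℝ)| ≤ ∑ i, ((M i : ℝ) ^ 2 / 10 + 5 / 2) := by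
    refine Finset.sum_le_sum fun i _ => ?_
    have := sq_nonneg (|(M i : ℝ)| - 5)
    rw [sub_sq, sq_abs] at this
    linarith
  rw [Finset.sum_add_distrib, ← Finset.sum_div] at h2
  simp only [Finset.sum_const, Finset.card_univ, Fintype.card_fin, nsmul_eq_mul] at h2
  have h3 : ∑ i, |(M i : ℝ)| ≤ 5 * (d : ℝ) := by linarith
  exact_mod_cast h3

theorem mem_grid {d : ℕ} (hd : 0 < d) {M : Fin d → ℤ} :
    M ∈ grid d ↔ ‖latticePoint M‖ ≤ 5 / 4 := by
  classical
  simp only [grid, Finset.mem_filter, Fintype.mem_piFinset, Finset.mem_Icc, and_iff_right_iff_imp]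
  intro hM i
  have h1 := sum_abs_le_of_norm_latticePoint_le hd hM
  have h2 := Finset.single_le_sum (f := fun i => |M i|) (fun _ _ => abs_nonneg _)
    (Finset.mem_univ i)
  exact abs_le.1 (h2.trans h1)

theorem hasSum_half_pow_natAbs : HasSum (fun n : ℤ => (1 / 2 : ℝ) ^ n.natAbs) 3 := by
  rw [show (3:ℝ) = 2 + 1 by norm_num]
  refine HasSum.of_nat_of_neg_add_one ?_ ?_
  · simpa using hasSum_geometric_two
  · have h := hasSum_geometric_two.mul_left (1 / 2 : ℝ)
    rw [show (1 / 2 : ℝ) * 2 = 1 by norm_num] at h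
    refine h.congr_fun fun n => ?_
    rw [Int.natAbs_neg, show ((n:ℤ) + 1).natAbs = n + 1 by omega, pow_succ, mul_comm]

/-- A generating function count: each grid point satisfies `∑ |M_i| ≤ 5d`, so `32^d ∏ 2^(-|M_i|) ≥
1`. Summing this weight over all integer vectors factorizes into `32^d · 3^d`. -/
theorem card_grid_le {d : ℕ} (hd : 0 < d) : ((grid d).card : ℝ) ≤ 96 ^ d := by
  classical
  calc ((grid d).card : ℝ) = ∑ M ∈ grid d, (1:ℝ) := by simp
    _ ≤ ∑ M ∈ grid d, 32 ^ d * ∏ i, (1 / 2 : ℝ) ^ (M i).natAbs := by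
        refine Finset.sum_le_sum fun M hM => ?_
        have h := sum_abs_le_of_norm_latticePoint_le hd ((mem_grid hd).1 hM)
        have h' : ∑ i, (M i).natAbs ≤ 5 * d := by
          zify
          exact h
        rw [Finset.prod_pow_eq_pow_sum]
        calc (1:ℝ) = 32 ^ d * (1 / 2) ^ (5 * d) := by
              rw [pow_mul, ← mul_pow]
              norm_num
          _ ≤ _ := by
              gcongr 32 ^ d * ?_
              exact pow_le_pow_of_le_one (by norm_num) (by norm_num) h'
    _ ≤ ∑ M ∈ Fintype.piFinset fun _ : Fin d => Finset.Icc (-(5 * d : ℤ)) (5 * d),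
          32 ^ d * ∏ i, (1 / 2 : ℝ) ^ (M i).natAbs := by
        refine Finset.sum_le_sum_of_subset_of_nonneg ?_ fun _ _ _ => by positivity
        unfold grid
        convert Finset.filter_subset _ _
    _ = 32 ^ d * (∑ n ∈ Finset.Icc (-(5 * d : ℤ)) (5 * d), (1 / 2 : ℝ) ^ n.natAbs) ^ d := by
        rw [← Finset.mul_sum, Finset.sum_prod_piFinset _ fun _ (n : ℤ) => (1 / 2 : ℝ) ^ n.natAbs]
        simp
    _ ≤ 32 ^ d * 3 ^ d := by
        gcongr
        exact sum_le_hasSum _ (fun _ _ => by positivity) hasSum_half_pow_natAbs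
    _ = 96 ^ d := by
        rw [← mul_pow]
        norm_num

theorem norm_latticePoint_le_of_abs_sub_le {d : ℕ} (hd : 0 < d) {z : EuclideanSpace ℝ (Fin d)}
    (hz : ‖z‖ ≤ 1) {M : Fin d → ℤ} (hM : ∀ i, |4 * √(d : ℝ) * z i - M i| ≤ 1) :
    ‖latticePoint M‖ ≤ 5 / 4 := by
  have hd' : (0:ℝ) < d := by exact_mod_cast hd
  have h : ‖z - latticePoint M‖ ≤ 1 / 4 := by
    refine abs_le_of_sq_le_sq' ?_ (by norm_num) |>.2
    rw [EuclideanSpace.norm_sq_eq]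
    calc ∑ i, ‖(z - latticePoint M) i‖ ^ 2 ≤ ∑ _i : Fin d, 1 / (16 * (d:ℝ)) := by
          refine Finset.sum_le_sum fun i _ => ?_
          have h1 : (z - latticePoint M) i = (4 * √(d : ℝ) * z i - M i) / (4 * √(d : ℝ)) := by
            simp only [latticePoint, PiLp.sub_apply]
            field_simp
          rw [h1, Real.norm_eq_abs, abs_div, div_pow, sq_abs (4 * _), mul_pow,
            Real.sq_sqrt hd'.le]
          norm_num only
          gcongr
          exact pow_le_one₀ (abs_nonneg _) (hM i)
      _ = (1 / 4) ^ 2 := by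
          simp only [Finset.sum_const, Finset.card_univ, Fintype.card_fin, nsmul_eq_mul]
          field_simp
          norm_num
  have := norm_le_norm_add_norm_sub z (latticePoint M)
  linarith

/-- A point of the unit ball lies in the hull of the vertices of its lattice cell. These are within
`1/4` of it, since each coordinate is off by at most the mesh `1/(4√d)`; this explains the radius
`5/4` of the grid. -/
theorem exists_convex_combination_grid {d : ℕ} (hd : 0 < d) {z : EuclideanSpace ℝ (Fin d)}
    (hz : ‖z‖ ≤ 1) :
    ∃ (ι : Type) (_ : Fintype ι) (w : ι → ℝ) (M : ι → Fin d → ℤ), (∀ a, 0 ≤ w a) ∧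
      ∑ a, w a = 1 ∧ (∀ a, M a ∈ grid d) ∧ ∑ a, w a • latticePoint (M a) = z := by
  have hd' : (0:ℝ) < d := by exact_mod_cast hd
  let s : ℝ := 4 * √(d : ℝ)
  have hs : 0 < s := by positivity
  let A : Fin d → Set ℝ := fun i => {(⌊s * z i⌋ : ℝ), (⌊s * z i⌋ : ℝ) + 1}
  have hmem : (fun i => s * z i) ∈ convexHull ℝ (Set.univ.pi A) := by
    rw [convexHull_pi, Set.mem_univ_pi]
    intro i
    rw [convexHull_pair, segment_eq_Icc (by linarith)]
    exact ⟨Int.floor_le _, (Int.lt_floor_add_one _).le⟩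
  obtain ⟨ι, hι, w, y, hw0, hw1, hy, hsum⟩ := mem_convexHull_iff_exists_fintype.1 hmem
  have hint : ∀ a i, ∃ n : ℤ, y a i = n ∧ |s * z i - n| ≤ 1 := by
    intro a i
    have h1 := Int.floor_le (s * z i)
    have h2 := Int.lt_floor_add_one (s * z i)
    rcases Set.mem_univ_pi.1 (hy a) i with h | h
    · exact ⟨⌊s * z i⌋, h, abs_le.2 ⟨by linarith, by linarith⟩⟩
    · refine ⟨⌊s * z i⌋ + 1, by push_cast; exact h, abs_le.2 ⟨?_, ?_⟩⟩ <;> push_cast <;> linarith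
  choose M hM1 hM2 using hint
  refine ⟨ι, hι, w, M, hw0, hw1, fun a => (mem_grid hd).2 <|
    norm_latticePoint_le_of_abs_sub_le hd hz (hM2 a), ?_⟩
  ext i
  have := congrFun hsum i
  simp only [Finset.sum_apply, Pi.smul_apply, smul_eq_mul, hM1] at this
  simp only [latticePoint, WithLp.ofLp_sum, WithLp.ofLp_smul, Finset.sum_apply, Pi.smul_apply,
    smul_eq_mul, ← mul_div_assoc]
  rw [← Finset.sum_div, this]
  exact mul_div_cancel_left₀ _ hs.ne'

/-- For `‖z‖ ≤ 1`, writing `z` as a convex combination of grid points makes `z^{⊗p}` a convex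
combination of grid tensors, with product weights summing to one. Homogeneity of degree `p` gives
the general case. -/
theorem abs_inner_pureTensor_le {d e p : ℕ} (hd : 0 < d) (x : TensorSpace d e p)
    (v : EuclideanSpace ℝ (Fin e)) {t : ℝ}
    (h : ∀ Y : Fin p → grid d, |inner ℝ x (pureTensor (fun i => latticePoint (Y i).1) v)| ≤ t)
    (z : EuclideanSpace ℝ (Fin d)) :
    |inner ℝ x (pureTensor (fun _ : Fin p => z) v)| ≤ ‖z‖ ^ p * t := by
  have hball : ∀ z : EuclideanSpace ℝ (Fin d), ‖z‖ ≤ 1 →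
      |inner ℝ x (pureTensor (fun _ : Fin p => z) v)| ≤ t := by
    intro z hz
    obtain ⟨ι, _, w, M, hw0, hw1, hM, rfl⟩ := exists_convex_combination_grid hd hz
    rw [pureTensor_sum, inner_sum]
    calc |∑ c : Fin p → ι, inner ℝ x
            ((∏ i, w (c i)) • pureTensor (fun i => latticePoint (M (c i))) v)|
        ≤ ∑ c : Fin p → ι, (∏ i, w (c i)) * t := by
          refine (Finset.abs_sum_le_sum_abs _ _).trans (Finset.sum_le_sum fun c _ => ?_)
          have hw : 0 ≤ ∏ i, w (c i) := Finset.prod_nonneg fun i _ => hw0 _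
          rw [inner_smul_right, abs_mul, abs_of_nonneg hw]
          exact mul_le_mul_of_nonneg_left (h fun i => ⟨M (c i), hM _⟩) hw
      _ = t := by
          classical
          rw [← Finset.sum_mul, ← Fintype.piFinset_univ, ← Finset.prod_univ_sum, hw1]
          simp
  have hz : z = ‖z‖ • (‖z‖⁻¹ • z) := by
    rcases eq_or_ne z 0 with rfl | h0
    · simp
    · rw [smul_smul, mul_inv_cancel₀ (norm_ne_zero_iff.2 h0), one_smul]
  have hunit : ‖‖z‖⁻¹ • z‖ ≤ 1 := by
    rw [norm_smul, norm_inv, norm_norm]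
    exact inv_mul_le_one_of_le₀ le_rfl (norm_nonneg _)
  conv_lhs => rw [hz]
  rw [pureTensor_smul, inner_smul_right, abs_mul, abs_of_nonneg (by positivity)]
  gcongr
  exact hball _ hunit

/-! ### Uniform control of a sub-Gaussian functional over the coherent vectors -/

/-- The size, in units of the standard deviation, allowed for a functional on the tensors of degree
`p` built from grid points. -/
def tensorThreshold (d p : ℕ) : ℝ := √(2 * (25 / 16) ^ p * ((d + 1) * (3 + 5 * p)))

theorem tensorThreshold_sq (d p : ℕ) :
    tensorThreshold d p ^ 2 = 2 * (25 / 16) ^ p * ((d + 1) * (3 + 5 * p)) :=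
  Real.sq_sqrt (by positivity)

theorem tensorThreshold_nonneg (d p : ℕ) : 0 ≤ tensorThreshold d p := Real.sqrt_nonneg _

/-- Degree by degree, the pairing is at most `ν ∑ t_p ‖z‖^p / √p!` with `t_p` the threshold. Since
`t_p²` grows like `p (25/16)^p`, the factorial wins, and a weighted AM-GM inequality sums the series
with the right exponential. -/
theorem abs_inner_coherent_le {d e : ℕ} (hd : 0 < d) (w : FockSpace d e)
    (v : EuclideanSpace ℝ (Fin e)) {ν : ℝ} (hν : 0 ≤ ν)
    (h : ∀ (p : ℕ) (Y : Fin p → grid d),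
      |inner ℝ (w p) (pureTensor (fun i => latticePoint (Y i).1) v)| ≤ ν * tensorThreshold d p)
    (z : EuclideanSpace ℝ (Fin d)) :
    |inner ℝ w (coherent z v)| ≤ 14 * √((d : ℝ) + 1) * ν * Real.exp (‖z‖ ^ 2) := by
  set A : ℝ := 14 * √((d : ℝ) + 1) with hA
  have hA0 : 0 < A := by positivity
  have hA2 : A ^ 2 = 196 * (d + 1) := by
    rw [hA, mul_pow, Real.sq_sqrt (by positivity)]
    norm_num
  set s : ℝ := ‖z‖ ^ 2 with hs
  have hsum := lp.hasSum_inner (𝕜 := ℝ) w (coherent z v)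
  have h1 : HasSum (fun p : ℕ => ν / 2 * (A * Real.exp (-s)) * ((2 * s) ^ p / p.factorial))
      (ν / 2 * (A * Real.exp (-s)) * Real.exp (2 * s)) := by
    rw [Real.exp_eq_exp_ℝ]
    exact (NormedSpace.expSeries_div_hasSum_exp (𝔸 := ℝ) (2 * s)).mul_left _
  have h2 : HasSum (fun p : ℕ => ν / 2 * (Real.exp s / A * (2 * (d + 1))) *
        (3 * (25 / 32 : ℝ) ^ p + 5 * (p * (25 / 32 : ℝ) ^ p)))
      (ν / 2 * (Real.exp s / A * (2 * (d + 1))) * (3 * (1 - 25 / 32 : ℝ)⁻¹ +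
        5 * (25 / 32 / (1 - 25 / 32) ^ 2))) := by
    refine HasSum.mul_left _ ((HasSum.mul_left _ ?_).add (HasSum.mul_left _ ?_))
    · exact hasSum_geometric_of_lt_one (by norm_num) (by norm_num)
    · exact hasSum_coe_mul_geometric_of_norm_lt_one (by
        rw [Real.norm_of_nonneg (by norm_num)]
        norm_num)
  have hterm : ∀ p : ℕ, |inner ℝ (w p) (coherent z v p)| ≤
      ν / 2 * (A * Real.exp (-s)) * ((2 * s) ^ p / p.factorial) +
      ν / 2 * (Real.exp s / A * (2 * (d + 1))) *
        (3 * (25 / 32 : ℝ) ^ p + 5 * (p * (25 / 32 : ℝ) ^ p)) := by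
    intro p
    have hb := abs_inner_pureTensor_le hd (w p) v (h p) z
    have hf : (0:ℝ) < p.factorial := by positivity
    rw [coherent_apply, inner_smul_right, abs_mul, abs_of_nonneg (by positivity)]
    set x : ℝ := (√(p.factorial : ℝ))⁻¹ * ‖z‖ ^ p with hx
    have hx2 : x ^ 2 = s ^ p / p.factorial := by
      rw [hx, mul_pow, inv_pow, Real.sq_sqrt hf.le, hs, ← pow_mul, ← pow_mul, mul_comm p]
      field_simp
    set t := tensorThreshold d p with ht
    -- The factor `2^p` balances two series: `∑ (2s)^p / p! = exp (2s)`, and one in `(25/32)^p`,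
    -- convergent because `25/16 < 2`. The constant 14 in `A` is large enough for the two halves to
    -- sum to at most `ν A exp s`.
    set c : ℝ := A * Real.exp (-s) * 2 ^ p with hc
    have hc0 : 0 < c := by positivity
    have hamgm : x * t ≤ (c * x ^ 2 + t ^ 2 / c) / 2 := by
      have h0 : 0 ≤ (c * x - t) ^ 2 / c := by positivity
      have h3 : (c * x - t) ^ 2 / c = c * x ^ 2 + t ^ 2 / c - 2 * (x * t) := by
        field_simp
        ring
      linarith
    calc (√(p.factorial : ℝ))⁻¹ * |inner ℝ (w p) (pureTensor (fun _ => z) v)|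
        ≤ (√(p.factorial : ℝ))⁻¹ * (‖z‖ ^ p * (ν * t)) := by gcongr
      _ = ν * (x * t) := by rw [hx]; ring
      _ ≤ ν * ((c * x ^ 2 + t ^ 2 / c) / 2) := by gcongr
      _ = _ := by
          rw [hx2, ht, tensorThreshold_sq, hc, Real.exp_neg, mul_pow,
            show (25 / 16 : ℝ) = 25 / 32 * 2 by norm_num, mul_pow]
          field_simp
  have hfin := (h1.add h2)
  have hnorm : |inner ℝ w (coherent z v)| ≤ _ :=
    hsum.norm_le_of_bounded hfin hterm
  refine hnorm.trans ?_
  have hexp : Real.exp (-s) * Real.exp (2 * s) = Real.exp s := by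
    rw [← Real.exp_add]
    ring_nf
  have hd1 : (d:ℝ) + 1 = A ^ 2 / 196 := by rw [hA2]; ring
  calc ν / 2 * (A * Real.exp (-s)) * Real.exp (2 * s) +
        ν / 2 * (Real.exp s / A * (2 * (d + 1))) * (3 * (1 - 25 / 32 : ℝ)⁻¹ +
        5 * (25 / 32 / (1 - 25 / 32) ^ 2))
      = ν * A * Real.exp s * (1 / 2 + (1 / 196) * (3 * (1 - 25 / 32 : ℝ)⁻¹ +
        5 * (25 / 32 / (1 - 25 / 32) ^ 2))) := by
        rw [hd1, ← hexp]
        field_simp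
    _ ≤ ν * A * Real.exp s * 1 := by
        gcongr
        norm_num
    _ = _ := by ring

/-- The functional `x` has the sizes given by `tensorThreshold`, in units of `ν`, on all tensors
built from grid points. -/
def GridBounded {d : ℕ} (ν : ℝ) (x : FockSpace d (d + 1)) : Prop :=
  ∀ (p : ℕ) (j : Fin (d + 1)) (Y : Fin p → grid d),
    |inner ℝ (x p) (pureTensor (fun i => latticePoint (Y i).1) (EuclideanSpace.single j 1))| ≤
      ν * tensorThreshold d p

/-- In the exponent, `3(d+1)` pays for the `d + 1` value coordinates and the constants, because `e³
≥ 16`; `5p(d+1)` pays for the at most `96^(dp)` grid tensors and the factor `2^(-p)`, because `e⁵ ≥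
96`. -/
theorem union_weight_le {d : ℕ} (hd : 0 < d) (p : ℕ) :
    ((d : ℝ) + 1) * ((grid d).card : ℝ) ^ p * (2 * Real.exp (-((d + 1) * (3 + 5 * p)))) ≤
      1 / 8 * (1 / 2) ^ p := by
  have he : (2.7 : ℝ) ≤ Real.exp 1 := by linarith [Real.exp_one_gt_d9]
  have h3 : (16:ℝ) ≤ Real.exp 3 := by
    rw [show (3:ℝ) = ((3:ℕ):ℝ) * 1 by norm_num, Real.exp_nat_mul]
    calc (16:ℝ) ≤ 2.7 ^ 3 := by norm_num
      _ ≤ _ := by gcongr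
  have h5 : (96:ℝ) ≤ Real.exp 5 := by
    rw [show (5:ℝ) = ((5:ℕ):ℝ) * 1 by norm_num, Real.exp_nat_mul]
    calc (96:ℝ) ≤ 2.7 ^ 5 := by norm_num
      _ ≤ _ := by gcongr
  have hA : 16 * ((d:ℝ) + 1) ≤ Real.exp 3 ^ (d + 1) := by
    have h1 : ((d:ℝ) + 1) ≤ 16 ^ d := by
      exact_mod_cast Nat.lt_pow_self (n := d) (a := 16) (by norm_num)
    calc 16 * ((d:ℝ) + 1) ≤ 16 * 16 ^ d := by gcongr
      _ = 16 ^ (d + 1) := by ring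
      _ ≤ _ := by gcongr
  have hB : (96:ℝ) ^ d * 2 ≤ Real.exp 5 ^ (d + 1) := by
    calc (96:ℝ) ^ d * 2 ≤ 96 ^ d * 96 := by gcongr; norm_num
      _ = 96 ^ (d + 1) := by ring
      _ ≤ _ := by gcongr
  have hx : Real.exp ((d + 1) * (3 + 5 * p)) =
      Real.exp 3 ^ (d + 1) * (Real.exp 5 ^ (d + 1)) ^ p := by
    rw [← Real.exp_nat_mul, ← Real.exp_nat_mul, ← Real.exp_nat_mul, ← Real.exp_add]
    push_cast
    ring_nf
  rw [Real.exp_neg, hx, one_div_pow]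
  have hE3 : 0 < Real.exp 3 ^ (d + 1) := by positivity
  have hE5 : 0 < (Real.exp 5 ^ (d + 1)) ^ p := by positivity
  have hC : ((d : ℝ) + 1) * ((grid d).card : ℝ) ^ p * 2 * (8 * 2 ^ p) ≤
      Real.exp 3 ^ (d + 1) * (Real.exp 5 ^ (d + 1)) ^ p := by
    calc ((d : ℝ) + 1) * ((grid d).card : ℝ) ^ p * 2 * (8 * 2 ^ p)
        = 16 * ((d:ℝ) + 1) * ((grid d).card * 2) ^ p := by rw [mul_pow]; ring
      _ ≤ 16 * ((d:ℝ) + 1) * (96 ^ d * 2) ^ p := by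
          gcongr
          exact card_grid_le hd
      _ ≤ _ := by gcongr
  rw [← mul_assoc, ← div_eq_mul_inv, div_le_iff₀ (by positivity)]
  field_simp
  linarith

theorem WeightedSubGaussian.tsum_exceeds_le {α : Type*} {d : ℕ} (hd : 0 < d) {μ : α → ℝ≥0∞}
    {W : α → FockSpace d (d + 1)} {ν : ℝ} (hν : 0 < ν) (h : WeightedSubGaussian μ W (ν ^ 2)) :
    ∑' a, {a | ¬ GridBounded ν (W a)}.indicator μ a ≤ 1 / 4 := by
  classical
  let bad (p : ℕ) (c : Fin (d + 1) × (Fin p → grid d)) : Set α := {a | ν * tensorThreshold d p <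
      |inner ℝ (W a p) (pureTensor (fun i => latticePoint (c.2 i).1)
        (EuclideanSpace.single c.1 1))|}
  have hbad : ∀ p c, ∑' a, (bad p c).indicator μ a ≤
      ENNReal.ofReal (2 * Real.exp (-((d + 1) * (3 + 5 * p)))) := by
    intro p c
    set x : TensorSpace d (d + 1) p := pureTensor (fun i => latticePoint (c.2 i).1)
        (EuclideanSpace.single c.1 1) with hx
    have hxn : ‖(lp.single 2 p x : FockSpace d (d + 1))‖ ≤ (5 / 4) ^ p := by
      rw [lp.norm_single (by norm_num), hx, norm_pureTensor, PiLp.norm_single, norm_one,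
        mul_one]
      calc ∏ i, ‖latticePoint (c.2 i).1‖ ≤ ∏ _i : Fin p, (5 / 4 : ℝ) :=
            Finset.prod_le_prod (fun _ _ => norm_nonneg _)
              fun i _ => (mem_grid hd).1 (c.2 i).2
        _ = _ := by rw [Finset.prod_const, Finset.card_univ, Fintype.card_fin]
    have hset : bad p c = {a | ν * tensorThreshold d p <
        |inner ℝ (W a) (lp.single 2 p x : FockSpace d (d + 1))|} := by
      ext a
      simp only [bad, Set.mem_ofPred_eq, lp.inner_single_right, hx]
    rw [hset]
    -- This is the optimal Chernoff multiplier when the squared norm of the test vector is replaced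
    -- by its bound `(25/16)^p`.
    refine (h.tsum_lt_abs_inner_le _ (tensorThreshold d p / (ν * (25 / 16) ^ p)) _
      (div_nonneg (tensorThreshold_nonneg _ _) (by positivity))).trans
        (ENNReal.ofReal_le_ofReal ?_)
    gcongr 2 * Real.exp ?_
    have ht := tensorThreshold_nonneg d p
    calc ν ^ 2 * (tensorThreshold d p / (ν * (25 / 16) ^ p) *
            ‖(lp.single 2 p x : FockSpace d (d + 1))‖) ^ 2 / 2 -
          tensorThreshold d p / (ν * (25 / 16) ^ p) * (ν * tensorThreshold d p)
        ≤ ν ^ 2 * (tensorThreshold d p / (ν * (25 / 16) ^ p) * (5 / 4) ^ p) ^ 2 / 2 -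
          tensorThreshold d p / (ν * (25 / 16) ^ p) * (ν * tensorThreshold d p) := by
          gcongr
      _ = -(tensorThreshold d p ^ 2 / (25 / 16) ^ p / 2) := by
          have h54 : ((5 / 4 : ℝ) ^ p) ^ 2 = (25 / 16) ^ p := by
            rw [← pow_mul, mul_comm, pow_mul]
            norm_num
          rw [mul_pow (_ / _), h54]
          field_simp
          ring
      _ = _ := by
          rw [tensorThreshold_sq]
          field_simp
  calc _ ≤ ∑' a, ∑' p, ∑ c, (bad p c).indicator μ a := by
        refine ENNReal.tsum_le_tsum fun a => ?_
        by_cases ha : GridBounded ν (W a)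
        · rw [Set.indicator_of_notMem (show a ∉ {a | ¬ GridBounded ν (W a)} from not_not.2 ha)]
          exact bot_le
        · rw [Set.indicator_of_mem (show a ∈ {a | ¬ GridBounded ν (W a)} from ha)]
          simp only [GridBounded, not_forall, not_le] at ha
          obtain ⟨p, j, Y, hY⟩ := ha
          calc μ a = (bad p (j, Y)).indicator μ a := by
                rw [Set.indicator_of_mem]
                exact hY
            _ ≤ ∑ c, (bad p c).indicator μ a :=
                Finset.single_le_sum (f := fun c => (bad p c).indicator μ a)
                  (fun _ _ => bot_le) (Finset.mem_univ (j, Y))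
            _ ≤ _ := ENNReal.le_tsum p
    _ = ∑' p, ∑ c, ∑' a, (bad p c).indicator μ a := by
        rw [ENNReal.tsum_comm]
        refine tsum_congr fun p => ?_
        rw [Summable.tsum_finsetSum fun _ _ => ENNReal.summable]
    _ ≤ ∑' p : ℕ, ENNReal.ofReal (1 / 8 * (1 / 2) ^ p) := by
        refine ENNReal.tsum_le_tsum fun p => ?_
        calc ∑ c, ∑' a, (bad p c).indicator μ a
            ≤ ∑ _c : Fin (d + 1) × (Fin p → grid d),
              ENNReal.ofReal (2 * Real.exp (-((d + 1) * (3 + 5 * p)))) :=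
              Finset.sum_le_sum fun c _ => hbad p c
          _ = ENNReal.ofReal (((d : ℝ) + 1) * ((grid d).card : ℝ) ^ p *
              (2 * Real.exp (-((d + 1) * (3 + 5 * p))))) := by
              rw [Finset.sum_const, nsmul_eq_mul,
                ENNReal.ofReal_mul (p := ((d : ℝ) + 1) * _) (by positivity)]
              congr 1
              rw [Finset.card_univ, Fintype.card_prod, Fintype.card_fin, Fintype.card_fun,
                Fintype.card_coe, Fintype.card_fin, ← ENNReal.ofReal_natCast]
              push_cast
              rfl
          _ ≤ _ := ENNReal.ofReal_le_ofReal (union_weight_le hd p)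
    _ = 1 / 4 := by
        have hs := hasSum_geometric_two.mul_left (1 / 8 : ℝ)
        rw [← ENNReal.ofReal_tsum_of_nonneg (fun p => by positivity) hs.summable, hs.tsum_eq]
        rw [show (1 / 8 * 2 : ℝ) = 4⁻¹ by norm_num, ENNReal.ofReal_inv_of_pos (by norm_num)]
        simp

/-! ### Features centred at a reference key -/

/-- The feature vector of a key-value pair, in the coordinates centred at `-c`. -/
def centredFeature {d e : ℕ} (c k : EuclideanSpace ℝ (Fin d)) (v : EuclideanSpace ℝ (Fin e)) :
    FockSpace d e :=
  Real.exp (-(‖c‖ ^ 2 / 2) - inner ℝ c k) • coherent (k + c) v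

/-- The kernel is invariant under translating both arguments by `c`, up to factors depending on one
argument each; the scalar in the feature cancels these. Hence `c` can be chosen freely in the
analysis, without affecting the algorithm. -/
theorem inner_centredFeature {d e : ℕ} (c k k' : EuclideanSpace ℝ (Fin d))
    (v v' : EuclideanSpace ℝ (Fin e)) :
    inner ℝ (centredFeature c k v) (centredFeature c k' v') =
      Real.exp (inner ℝ k k') * inner ℝ v v' := by
  rw [centredFeature, centredFeature, inner_smul_left, inner_smul_right, inner_coherent,
    conj_trivial, ← mul_assoc, ← mul_assoc, ← Real.exp_add, ← Real.exp_add]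
  congr 2
  rw [inner_add_left, inner_add_right, inner_add_right, real_inner_self_eq_norm_sq,
    real_inner_comm c k]
  ring

/-- The prefactor does not depend on `k` or `v`, so it comes out of sums over key-value pairs. -/
theorem inner_centredFeature_coherent {d e : ℕ} (c k q : EuclideanSpace ℝ (Fin d))
    (v u : EuclideanSpace ℝ (Fin e)) :
    inner ℝ (centredFeature c k v) (coherent (q + c) u) =
      Real.exp (inner ℝ q c + ‖c‖ ^ 2 / 2) * (Real.exp (inner ℝ q k) * inner ℝ v u) := by
  rw [centredFeature, inner_smul_left, inner_coherent, conj_trivial, ← mul_assoc, ← mul_assoc,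
    ← Real.exp_add, ← Real.exp_add]
  congr 2
  rw [inner_add_left, inner_add_right, inner_add_right, real_inner_self_eq_norm_sq,
    real_inner_comm c k, real_inner_comm q k, real_inner_comm q c]
  ring

/-! ### Attention from thinned key-value pairs -/

theorem attention_apply {ι κ : Type*} [Fintype ι] [DecidableEq ι] [Fintype κ] {d : ℕ}
    (q : ι → EuclideanSpace ℝ (Fin d)) (k v : κ → EuclideanSpace ℝ (Fin d)) (i : ι) (j : Fin d) :
    attention q k v i j = (∑ l, Real.exp (inner ℝ (q i) (k l) / √(d : ℝ)) * v l j) /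
      ∑ l, Real.exp (inner ℝ (q i) (k l) / √(d : ℝ)) := by
  rw [attention, Matrix.mul_apply]
  simp only [Matrix.diagonal_mul, attentionMatrix, rowsMatrix, Matrix.of_apply]
  rw [div_eq_inv_mul, Finset.mul_sum]
  exact Finset.sum_congr rfl fun l _ => mul_assoc _ _ _

/-- The two denominator errors enter through `t/s`, which is at most `a` in absolute value; so
controlling the denominator error scaled by `a` suffices, and no lower bound on the thinned
denominator `s` is needed. -/
theorem abs_div_sub_div_le {Z s N t c a β : ℝ} (hZ : 0 < Z) (hs : 0 < s) (ht : |t| ≤ a * s)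
    (hN : |N - c * t| ≤ β) (hD : |(Z - c * s) * a| ≤ β) : |t / s - N / Z| ≤ 2 * β / Z := by
  have h : t / s - N / Z = (t / s * (Z - c * s) - (N - c * t)) / Z := by
    field_simp
    ring
  have ha : |t / s| ≤ |a| := by
    rw [abs_div, abs_of_pos hs, div_le_iff₀ hs]
    exact ht.trans (by gcongr; exact le_abs_self a)
  rw [h, abs_div, abs_of_pos hZ]
  gcongr
  calc |t / s * (Z - c * s) - (N - c * t)| ≤ |t / s * (Z - c * s)| + |N - c * t| := abs_sub _ _
    _ ≤ |(Z - c * s) * a| + |N - c * t| := by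
        rw [abs_mul, abs_mul, mul_comm]
        gcongr
    _ ≤ 2 * β := by linarith

/-- Jensen's inequality for the exponential, through its tangent at the mean. -/
theorem card_mul_exp_inner_mean_le {n d : ℕ} (hn : 0 < n) (q : EuclideanSpace ℝ (Fin d))
    (k : Fin n → EuclideanSpace ℝ (Fin d)) :
    n * Real.exp (inner ℝ q ((n : ℝ)⁻¹ • ∑ i, k i)) ≤ ∑ i, Real.exp (inner ℝ q (k i)) := by
  have hn' : (n:ℝ) ≠ 0 := by positivity
  set x := inner ℝ q ((n : ℝ)⁻¹ • ∑ i, k i) with hx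
  have hsum : ∑ i, inner ℝ q (k i) = n * x := by
    rw [hx, inner_smul_right, inner_sum, mul_inv_cancel_left₀ hn']
  calc n * Real.exp x = ∑ i, Real.exp x * (1 + (inner ℝ q (k i) - x)) := by
        rw [← Finset.mul_sum, Finset.sum_add_distrib, Finset.sum_sub_distrib, hsum]
        simp
        ring
    _ ≤ ∑ i, Real.exp (inner ℝ q (k i)) := by
        refine Finset.sum_le_sum fun i _ => ?_
        calc Real.exp x * (1 + (inner ℝ q (k i) - x))
            ≤ Real.exp x * Real.exp (inner ℝ q (k i) - x) := by
              gcongr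
              linarith [Real.add_one_le_exp (inner ℝ q (k i) - x)]
          _ = _ := by rw [← Real.exp_add, add_sub_cancel]

theorem norm_mean_le {n d : ℕ} (hn : 0 < n) (k : Fin n → EuclideanSpace ℝ (Fin d)) {r : ℝ}
    (hk : ∀ i, ‖k i‖ ≤ r) : ‖(n : ℝ)⁻¹ • ∑ i, k i‖ ≤ r := by
  have hn' : (0:ℝ) < n := by exact_mod_cast hn
  rw [norm_smul, norm_inv, Real.norm_of_nonneg hn'.le, inv_mul_le_iff₀ hn']
  calc ‖∑ i, k i‖ ≤ ∑ _i : Fin n, r := norm_sum_le_of_le _ fun i _ => hk i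
    _ = n * r := by simp

/-- The error of the normalized sums over a sublist, in terms of the imbalance of the features. -/
theorem abs_softmax_sub_le {n d : ℕ} (hd : 0 < d) (hn : 0 < n)
    (k : Fin n → EuclideanSpace ℝ (Fin d)) (v : Fin n → EuclideanSpace ℝ (Fin (d + 1)))
    {a r : ℝ} (hlast : ∀ i, v i (Fin.last d) = a) (hv : ∀ i j, |v i j| ≤ a)
    (hk : ∀ i, ‖k i‖ ≤ r) {ν C : ℝ} (hν : 0 ≤ ν) {T : List (Fin n)} (hT : T ≠ [])
    (hgood : GridBounded ν (((List.finRange n).map fun i =>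
      centredFeature ((n : ℝ)⁻¹ • ∑ i, k i) (k i) (v i)).sum - C • (T.map fun i =>
      centredFeature ((n : ℝ)⁻¹ • ∑ i, k i) (k i) (v i)).sum))
    (q : EuclideanSpace ℝ (Fin d)) (hq : ‖q‖ ≤ r) (j : Fin (d + 1)) :
    |(T.map fun i => Real.exp (inner ℝ q (k i)) * v i j).sum /
        (T.map fun i => Real.exp (inner ℝ q (k i))).sum -
      (∑ i, Real.exp (inner ℝ q (k i)) * v i j) / ∑ i, Real.exp (inner ℝ q (k i))| ≤
    28 * √((d : ℝ) + 1) * ν * Real.exp (3 / 2 * r ^ 2) / n := by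
  have hn' : (0:ℝ) < n := by exact_mod_cast hn
  set c := (n : ℝ)⁻¹ • ∑ i, k i with hc
  have hcr : ‖c‖ ≤ r := norm_mean_le hn k hk
  set x := ((List.finRange n).map fun i => centredFeature c (k i) (v i)).sum -
    C • (T.map fun i => centredFeature c (k i) (v i)).sum with hx
  have hinner : ∀ j, inner ℝ x (coherent (q + c) (EuclideanSpace.single j 1)) =
      Real.exp (inner ℝ q c + ‖c‖ ^ 2 / 2) * ((∑ i, Real.exp (inner ℝ q (k i)) * v i j) -
        C * (T.map fun i => Real.exp (inner ℝ q (k i)) * v i j).sum) := by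
    intro j
    rw [hx, inner_sub_left, inner_smul_left, inner_list_sum_left, inner_list_sum_left,
      conj_trivial]
    simp only [inner_centredFeature_coherent, EuclideanSpace.inner_single_right, conj_trivial,
      one_mul]
    rw [List.sum_map_mul_left, List.sum_map_mul_left, ← List.ofFn_eq_map, List.sum_ofFn]
    ring
  set β := 14 * √((d : ℝ) + 1) * ν * Real.exp (‖q + c‖ ^ 2 - inner ℝ q c - ‖c‖ ^ 2 / 2) with hβ
  have hdiff : ∀ j, |(∑ i, Real.exp (inner ℝ q (k i)) * v i j) -
        C * (T.map fun i => Real.exp (inner ℝ q (k i)) * v i j).sum| ≤ β := by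
    intro j
    have h := abs_inner_coherent_le hd x (EuclideanSpace.single j 1) hν (fun p Y => hgood p j Y)
      (q + c)
    rw [hinner, abs_mul, abs_of_pos (Real.exp_pos _), mul_comm, ← le_div_iff₀ (Real.exp_pos _),
      mul_div_assoc, ← Real.exp_sub] at h
    rw [hβ]
    refine h.trans (le_of_eq ?_)
    ring_nf
  have hZ := card_mul_exp_inner_mean_le hn q k
  rw [← hc] at hZ
  have hZ0 : 0 < n * Real.exp (inner ℝ q c) := by positivity
  have hspos : 0 < (T.map fun i => Real.exp (inner ℝ q (k i))).sum :=
    List.sum_pos _ (by simp [Real.exp_pos]) (by simpa using hT)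
  have ht : |(T.map fun i => Real.exp (inner ℝ q (k i)) * v i j).sum| ≤
      a * (T.map fun i => Real.exp (inner ℝ q (k i))).sum := by
    rw [← List.sum_map_mul_left]
    clear hgood hx hinner hdiff hspos hT x
    induction T with
    | nil => simp
    | cons b T ih =>
      simp only [List.map_cons, List.sum_cons]
      refine (abs_add_le _ _).trans (add_le_add ?_ ih)
      rw [abs_mul, abs_of_pos (Real.exp_pos _), mul_comm]
      gcongr
      exact hv b j
  -- The last value coordinate is the constant `a`, so its numerator error is `a` times the
  -- denominator error.
  have hD := hdiff (Fin.last d)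
  simp only [hlast] at hD
  rw [← Finset.sum_mul, List.sum_map_mul_right, ← mul_assoc, ← sub_mul] at hD
  refine (abs_div_sub_div_le (hZ0.trans_le hZ) hspos ht (hdiff j) hD).trans ?_
  calc 2 * β / ∑ i, Real.exp (inner ℝ q (k i)) ≤ 2 * β / (n * Real.exp (inner ℝ q c)) := by
        gcongr
    _ = 28 * √((d : ℝ) + 1) * ν * Real.exp (‖q‖ ^ 2 + ‖c‖ ^ 2 / 2) / n := by
        -- With `c` the mean key, the cross term `2⟨q, c⟩` of `‖q + c‖²` cancels: one `⟨q, c⟩` is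
        -- the prefactor of the pairing, the other comes from Jensen's bound.
        have : Real.exp (‖q‖ ^ 2 + ‖c‖ ^ 2 / 2) = Real.exp (‖q + c‖ ^ 2 - inner ℝ q c -
            ‖c‖ ^ 2 / 2) / Real.exp (inner ℝ q c) := by
          rw [← Real.exp_sub, norm_add_sq_real]
          ring_nf
        rw [this, hβ]
        field_simp
        ring
    _ ≤ _ := by
        gcongr
        have h1 : ‖q‖ ^ 2 ≤ r ^ 2 := by gcongr
        have h2 : ‖c‖ ^ 2 ≤ r ^ 2 := by gcongr
        linarith

/-! ### Norms of the data -/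

theorem abs_le_maxNorm {ι κ : Type*} [Finite ι] [Finite κ] (M : Matrix ι κ ℝ) (i : ι) (j : κ) :
    |M i j| ≤ maxNorm M :=
  (le_ciSup (f := fun j => |M i j|) (Set.finite_range _).bddAbove j).trans
    (le_ciSup (f := fun i => ⨆ j, |M i j|) (Set.finite_range _).bddAbove i)

theorem maxNorm_le {ι κ : Type*} {M : Matrix ι κ ℝ} {b : ℝ} (hb : 0 ≤ b)
    (h : ∀ i j, |M i j| ≤ b) : maxNorm M ≤ b :=
  Real.iSup_le (fun i => Real.iSup_le (h i) hb) hb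

theorem norm_le_rowNorm {ι : Type*} [Finite ι] {d : ℕ} (v : ι → EuclideanSpace ℝ (Fin d)) (i : ι) :
    ‖v i‖ ≤ rowNorm (rowsMatrix v) :=
  le_ciSup (f := fun i => ‖WithLp.toLp 2 (rowsMatrix v i)‖) (Set.finite_range _).bddAbove i

theorem rowNorm_nonneg {ι : Type*} {d : ℕ} (M : Matrix ι (Fin d) ℝ) : 0 ≤ rowNorm M :=
  Real.iSup_nonneg fun _ => norm_nonneg _

theorem maxNorm_rowsMatrix_le {ι : Type*} [Finite ι] {d : ℕ} (v : ι → EuclideanSpace ℝ (Fin d)) :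
    maxNorm (rowsMatrix v) ≤ rowNorm (rowsMatrix v) :=
  maxNorm_le (rowNorm_nonneg _) fun i j =>
    (PiLp.norm_apply_le (v i) j).trans (norm_le_rowNorm v i)

theorem maxNorm_nonneg {ι κ : Type*} (M : Matrix ι κ ℝ) : 0 ≤ maxNorm M :=
  Real.iSup_nonneg fun _ => Real.iSup_nonneg fun _ => abs_nonneg _

theorem norm_le_radius {n d : ℕ} (q k : Fin n → EuclideanSpace ℝ (Fin d)) (i : Fin n) :
    ‖k i‖ ≤ radius q k ∧ ‖q i‖ ≤ radius q k := by
  have h := le_ciSup (f := fun i => max ‖k i‖ ‖q i‖) (Set.finite_range _).bddAbove i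
  exact ⟨(le_max_left _ _).trans h, (le_max_right _ _).trans h⟩

theorem inv_rpow_quarter_sq (d : ℕ) : (((d : ℝ) ^ (1 / 4 : ℝ))⁻¹) ^ 2 = (√(d : ℝ))⁻¹ := by
  rw [inv_pow, ← Real.rpow_natCast, ← Real.rpow_mul (by positivity), Real.sqrt_eq_rpow]
  norm_num

/-- Only the `√(d+1)` part of the constant is needed. The logarithm is at least `log (3e²) ≥ 3`,
which cancels the `√3`, and the second summand is nonnegative. -/
theorem errorConstant_ge (d : ℕ) (R a : ℝ) : 128 * √((d : ℝ) + 1) ≤ errorConstant d R a := by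
  have h3 : 3 ≤ Real.log (3 * Real.exp 1 ^ 2 * max 1 ((R ^ 2 / √(d : ℝ) + 2) * a)) := by
    rw [Real.le_log_iff_exp_le (by positivity)]
    calc Real.exp 3 = Real.exp 1 * Real.exp 1 ^ 2 * 1 := by
          rw [← Real.exp_nat_mul, ← Real.exp_add]
          norm_num
      _ ≤ _ := by
          gcongr
          · linarith [Real.exp_one_lt_d9]
          · exact le_max_left _ _
  have h0 : 0 ≤ √(Real.log 8) * (4 + 128 / √3) := by positivity
  calc 128 * √((d : ℝ) + 1) = 128 / √3 * √(((d : ℝ) + 1) * 3) := by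
        rw [Real.sqrt_mul (by positivity)]
        field_simp
    _ ≤ 128 / √3 * √(((d : ℝ) + 1) *
      Real.log (3 * Real.exp 1 ^ 2 * max 1 ((R ^ 2 / √(d : ℝ) + 2) * a))) := by gcongr
    _ ≤ _ := by
        rw [errorConstant]
        linarith

/-! ### The guarantee -/

section Guarantee

variable {n d : ℕ} (k v : Fin n → EuclideanSpace ℝ (Fin d))

theorem augmentedPair_snd_last (i : Fin n) :
    (augmentedPair k v i).2 (Fin.last d) = maxNorm (rowsMatrix v) := by
  simp [augmentedPair]

theorem augmentedPair_snd_castSucc (i : Fin n) (j : Fin d) :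
    (augmentedPair k v i).2 j.castSucc = v i j := by
  simp [augmentedPair]

theorem abs_augmentedPair_snd_le (i : Fin n) (j : Fin (d + 1)) :
    |(augmentedPair k v i).2 j| ≤ maxNorm (rowsMatrix v) := by
  induction j using Fin.lastCases with
  | last => rw [augmentedPair_snd_last, abs_of_nonneg (maxNorm_nonneg _)]
  | cast j =>
    rw [augmentedPair_snd_castSucc]
    exact abs_le_maxNorm (rowsMatrix v) i j

theorem norm_augmentedPair_snd_sq_le (i : Fin n) :
    ‖(augmentedPair k v i).2‖ ^ 2 ≤ 2 * rowNorm (rowsMatrix v) ^ 2 := by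
  have h1 := norm_le_rowNorm v i
  have h2 := maxNorm_rowsMatrix_le v
  have h3 := maxNorm_nonneg (rowsMatrix v)
  rw [EuclideanSpace.norm_sq_eq, Fin.sum_univ_castSucc, augmentedPair_snd_last]
  simp only [augmentedPair_snd_castSucc]
  rw [← EuclideanSpace.norm_sq_eq, Real.norm_of_nonneg h3, two_mul]
  gcongr

theorem norm_inv_rpow_smul_le {x : EuclideanSpace ℝ (Fin d)} {R : ℝ} (hx : ‖x‖ ≤ R) :
    ‖((d : ℝ) ^ (1 / 4 : ℝ))⁻¹ • x‖ ≤ ((d : ℝ) ^ (1 / 4 : ℝ))⁻¹ * R := by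
  rw [norm_smul, Real.norm_of_nonneg (by positivity)]
  gcongr

theorem inner_inv_rpow_smul (x y : EuclideanSpace ℝ (Fin d)) :
    inner ℝ (((d : ℝ) ^ (1 / 4 : ℝ))⁻¹ • x) (((d : ℝ) ^ (1 / 4 : ℝ))⁻¹ • y) =
      inner ℝ x y / √(d : ℝ) := by
  rw [inner_smul_left, inner_smul_right, conj_trivial, ← mul_assoc, ← sq, inv_rpow_quarter_sq,
    inv_mul_eq_div]

/-- The feature of a key-value pair, centred at the mean key. -/
def pairFeature (i : Fin n) : FockSpace d (d + 1) :=
  centredFeature ((n : ℝ)⁻¹ • ∑ l, (augmentedPair k v l).1) (augmentedPair k v i).1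
    (augmentedPair k v i).2

theorem attentionKernel_eq_inner (i j : Fin n) :
    attentionKernel (augmentedPair k v i) (augmentedPair k v j) =
      inner ℝ (pairFeature k v i) (pairFeature k v j) := by
  rw [pairFeature, pairFeature, inner_centredFeature, attentionKernel]

theorem norm_pairFeature_sq_le (q : Fin n → EuclideanSpace ℝ (Fin d)) (i : Fin n) :
    ‖pairFeature k v i‖ ^ 2 ≤
      Real.exp (radius q k ^ 2 / √(d : ℝ)) * (2 * rowNorm (rowsMatrix v) ^ 2) := by
  rw [← real_inner_self_eq_norm_sq, ← attentionKernel_eq_inner, attentionKernel,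
    real_inner_self_eq_norm_sq (augmentedPair k v i).2]
  gcongr
  · rw [augmentedPair, inner_inv_rpow_smul, real_inner_self_eq_norm_sq]
    gcongr
    exact (norm_le_radius q k i).1
  · exact norm_augmentedPair_snd_sq_le k v i

/-- The attention over a selection of the pairs is accurate if the features are balanced. -/
theorem maxNorm_attention_sub_le (hd : 0 < d) (hn : 0 < n) (q : Fin n → EuclideanSpace ℝ (Fin d))
    {ν C : ℝ} (hν : 0 ≤ ν) {T : List (Fin n)} (hT : T ≠ [])
    (hgood : GridBounded ν (((List.finRange n).map (pairFeature k v)).sum -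
      C • (T.map (pairFeature k v)).sum)) :
    maxNorm (attention q (fun l : Fin T.length => k (T.get l)) (fun l : Fin T.length => v (T.get l))
        - attention q k v) ≤
      28 * √((d : ℝ) + 1) * ν * Real.exp (3 / 2 * (radius q k ^ 2 / √(d : ℝ))) / n := by
  refine maxNorm_le (by positivity) fun i j => ?_
  set s : ℝ := ((d : ℝ) ^ (1 / 4 : ℝ))⁻¹ with hs
  have h := abs_softmax_sub_le hd hn (fun i => (augmentedPair k v i).1)
    (fun i => (augmentedPair k v i).2) (augmentedPair_snd_last k v) (abs_augmentedPair_snd_le k v)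
    (fun i => norm_inv_rpow_smul_le (norm_le_radius q k i).1) hν hT hgood (s • q i)
    (norm_inv_rpow_smul_le (norm_le_radius q k i).2) j.castSucc
  have hker : ∀ l, inner ℝ (s • q i) (augmentedPair k v l).1 = inner ℝ (q i) (k l) / √(d : ℝ) :=
    fun l => inner_inv_rpow_smul _ _
  rw [mul_pow, inv_rpow_quarter_sq, inv_mul_eq_div] at h
  simp only [hker, augmentedPair_snd_castSucc] at h
  rw [Matrix.sub_apply, attention_apply, attention_apply]
  have hsum : ∀ f : Fin n → ℝ, ∑ l : Fin T.length, f (T.get l) = (T.map f).sum :=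
    fun f => Fin.sum_univ_fun_getElem T f
  rw [hsum fun l => Real.exp (inner ℝ (q i) (k l) / √(d : ℝ)) * v l j,
    hsum fun l => Real.exp (inner ℝ (q i) (k l) / √(d : ℝ))]
  exact h

theorem attention_eq_zero {ι κ : Type*} [Fintype ι] [DecidableEq ι] [Fintype κ]
    (q : ι → EuclideanSpace ℝ (Fin d)) (k v : κ → EuclideanSpace ℝ (Fin d)) (hv : ∀ l, v l = 0) :
    attention q k v = 0 := by
  ext i j
  simp [attention_apply, hv]

end Guarantee

/-- A sub-Gaussian random vector in the Fock space is bounded on the grid with probability at least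
`3 / 4 - ε`. -/
theorem SubGaussianOff.le_toOuterMeasure {α : Type*} {d : ℕ} (hd : 0 < d) {p : PMF α}
    {W : α → FockSpace d (d + 1)} {ν : ℝ} (hν : 0 < ν) {ε : ℝ≥0∞}
    (h : SubGaussianOff p W (ν ^ 2) ε) {A : Set α}
    (hA : ∀ a ∈ p.support, GridBounded ν (W a) → a ∈ A) :
    1 ≤ p.toOuterMeasure A + 1 / 4 + ε := by
  classical
  obtain ⟨μ, h1, h2, h3⟩ := h
  refine h2.trans ?_
  gcongr
  rw [PMF.toOuterMeasure_apply]
  refine le_trans ?_ (add_le_add_right (h3.tsum_exceeds_le hd hν) _)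
  rw [← ENNReal.tsum_add]
  refine ENNReal.tsum_le_tsum fun a => ?_
  by_cases ha : a ∈ p.support
  · by_cases hg : GridBounded ν (W a)
    · rw [Set.indicator_of_mem (hA a ha hg)]
      exact (h1 a).trans le_self_add
    · rw [Set.indicator_of_mem (show a ∈ {a | ¬ GridBounded ν (W a)} from hg)]
      exact le_add_self
  · have := h1 a
    rw [(PMF.apply_eq_zero_iff p a).2 ha] at this
    exact this.trans bot_le

/-- The deviation allowed for the selected features implies the stated error bound. -/
theorem deviation_le_bound {d g m : ℕ} (R a b : ℝ) (hm : 0 < m) (hb : 0 ≤ b) {ν : ℝ} (hν0 : 0 ≤ ν)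
    (hν : ν ^ 2 = 2 * m * 4 ^ m * (Real.exp (R ^ 2 / √(d : ℝ)) * (2 * b ^ 2)) *
      Real.log (8 * 2 ^ (2 * g + m) * m)) :
    28 * √((d : ℝ) + 1) * ν * Real.exp (3 / 2 * (R ^ 2 / √(d : ℝ))) / ((4 ^ (g + m) : ℕ) : ℝ) ≤
      errorConstant d R a * Real.exp (2 * R ^ 2 / √(d : ℝ)) * b *
        √(Real.logb 2 ((2 ^ g * 2 ^ (g + m) : ℕ) : ℝ) *
          Real.log (8 * ((2 ^ g * 2 ^ (g + m) : ℕ) : ℝ) *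
            Real.logb 2 (((4 ^ (g + m) : ℕ) : ℝ) / ((2 ^ g * 2 ^ (g + m) : ℕ) : ℝ)))) /
        ((2 ^ g * 2 ^ (g + m) : ℕ) : ℝ) := by
  have hm1 : (1:ℝ) ≤ m := by exact_mod_cast hm
  have hnout : ((2 ^ g * 2 ^ (g + m) : ℕ) : ℝ) = 2 ^ (2 * g + m) := by
    push_cast
    rw [← pow_add]
    ring_nf
  have h4 : ∀ j : ℕ, (4:ℝ) ^ j = 2 ^ j * 2 ^ j := fun j => by
    rw [← mul_pow]
    norm_num
  have hn : ((4 ^ (g + m) : ℕ) : ℝ) = 2 ^ (2 * g + m) * 2 ^ m := by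
    push_cast
    rw [h4, ← pow_add, ← pow_add]
    ring_nf
  rw [hnout, hn, mul_div_cancel_left₀ _ (by positivity), Real.logb_pow, Real.logb_pow,
    Real.logb_self_eq_one (by norm_num), mul_one, mul_one]
  set N : ℝ := 2 ^ (2 * g + m) with hN
  have hN1 : 1 ≤ N := one_le_pow₀ (by norm_num)
  set L := Real.log (8 * N * m) with hL
  have hL0 : 0 ≤ L := Real.log_nonneg (by nlinarith)
  set ρ := R ^ 2 / √(d : ℝ) with hρ
  have hνeq : ν = 2 * 2 ^ m * Real.exp (ρ / 2) * b * √(m * L) := by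
    rw [← sq_eq_sq₀ hν0 (by positivity), hν, mul_pow, Real.sq_sqrt (by positivity), mul_pow,
      mul_pow, ← Real.exp_nat_mul, h4]
    push_cast
    rw [mul_div_cancel₀ ρ (by norm_num : (2:ℝ) ≠ 0)]
    ring
  have hexp : Real.exp (ρ / 2) * Real.exp (3 / 2 * ρ) = Real.exp (2 * R ^ 2 / √(d : ℝ)) := by
    rw [← Real.exp_add, mul_div_assoc, ← hρ]
    ring_nf
  calc 28 * √((d : ℝ) + 1) * ν * Real.exp (3 / 2 * ρ) / (N * 2 ^ m)
      = 56 * √((d : ℝ) + 1) * Real.exp (2 * R ^ 2 / √(d : ℝ)) * b * √(m * L) / N := by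
        rw [hνeq, ← hexp]
        field_simp
        ring
    _ ≤ errorConstant d R a * Real.exp (2 * R ^ 2 / √(d : ℝ)) * b *
          √(((2 * g + m : ℕ) : ℝ) * L) / N := by
        have hc : 56 * √((d : ℝ) + 1) ≤ errorConstant d R a :=
          le_trans (by gcongr; norm_num) (errorConstant_ge d R a)
        have hc0 : 0 ≤ errorConstant d R a := le_trans (by positivity) hc
        -- The proof produces `m = log₂ (n_in / n_out)`; the stated bound has the larger `log₂ n_out
        -- = 2g + m`.
        have hgm : (m : ℝ) ≤ ((2 * g + m : ℕ) : ℝ) := by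
          exact_mod_cast Nat.le_add_left m (2 * g)
        gcongr

end Thinformer

end

/-! ### The probability budget and the final bound -/

theorem theorem2 (d n nout g m : ℕ) (hd : 0 < d) (hm : 0 < m)
    (hn : n = 4 ^ (g + m)) (hnout : nout = 2 ^ g * 2 ^ (g + m))
    (P : Thinformer.QuarteringRule (Fin n)) (q k v : Fin n → EuclideanSpace ℝ (Fin d)) :
    (1 / 2 : ENNReal) ≤
      (Thinformer.thinformer P g m q k v).toOuterMeasure
        {That | Thinformer.maxNorm (That - Thinformer.attention q k v) ≤
          Thinformer.errorConstant d (Thinformer.radius q k)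
              (Thinformer.maxNorm (Thinformer.rowsMatrix v))
            * Real.exp (2 * Thinformer.radius q k ^ 2 / √(d : ℝ))
            * Thinformer.rowNorm (Thinformer.rowsMatrix v)
            * √(Real.logb 2 (nout : ℝ)
                * Real.log (8 * (nout : ℝ) * Real.logb 2 ((n : ℝ) / (nout : ℝ))))
            / (nout : ℝ)} := by
  subst hn hnout
  set b := Thinformer.rowNorm (Thinformer.rowsMatrix v) with hb
  have hb0 : 0 ≤ b := Thinformer.rowNorm_nonneg _
  rw [Thinformer.thinformer, Thinformer.khCompress, PMF.toOuterMeasure_map_apply,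
    List.length_finRange, show (0.5 : ℝ) = 1 / 2 by norm_num]
  -- If all values vanish, the variance proxy is zero and the Chernoff step, which needs `ν > 0`,
  -- does not apply; but then both attentions are zero.
  rcases hb0.eq_or_lt with hbz | hbpos
  · have hv : ∀ i, v i = 0 := fun i => norm_le_zero_iff.1 <| hbz ▸ Thinformer.norm_le_rowNorm v i
    refine le_trans ENNReal.half_le_self
      (le_of_eq (((PMF.toOuterMeasure_apply_eq_one_iff _ _).2 ?_).symm))
    intro T _
    rw [← hbz, Set.mem_preimage, Thinformer.attention_eq_zero q k v hv,
      Thinformer.attention_eq_zero q (fun l => k (T.get l)) (fun l => v (T.get l)) fun l => hv _]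
    exact Thinformer.maxNorm_le (by simp) (by simp)
  set L := Real.log (8 * 2 ^ (2 * g + m) * m) with hL
  set K := Real.exp (Thinformer.radius q k ^ 2 / √(d : ℝ)) * (2 * b ^ 2) with hK
  have hm1 : (1:ℝ) ≤ m := by exact_mod_cast hm
  have hL0 : 0 < L := Real.log_pos <| by
    have : (1:ℝ) ≤ 2 ^ (2 * g + m) := one_le_pow₀ (by norm_num)
    nlinarith
  have hV : 0 < 2 * m * 4 ^ m * K * L := by positivity
  have hsub := Thinformer.compress_subGaussianOff (Thinformer.attentionKernel_eq_inner k v)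
    (Thinformer.norm_pairFeature_sq_le k v q) P (g := g) hm (by positivity) m
    (List.finRange (4 ^ (g + m))) le_rfl List.length_finRange
  rw [← hb, ← hK, ← hL, ← Real.sq_sqrt hV.le] at hsub
  have hfail : ENNReal.ofReal (m * 4 ^ m / 4 ^ m / (4 * m)) = 1 / 4 := by
    rw [show (m * 4 ^ m / 4 ^ m / (4 * m) : ℝ) = 4⁻¹ by field_simp,
      ENNReal.ofReal_inv_of_pos (by norm_num)]
    simp
  rw [hfail] at hsub
  have hquarters : (1 / 4 : ENNReal) + 1 / 4 = 1 / 2 := by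
    rw [ENNReal.div_add_div_same, one_add_one_eq_two,
      (ENNReal.div_eq_div_iff (by simp) (by simp) (by simp) (by simp)).2
        (by norm_num : (2 : ENNReal) * 2 = 4 * 1)]
  refine ENNReal.le_of_add_le_add_right (a := 1 / 2) (by simp) ?_
  rw [ENNReal.add_halves, ← hquarters, ← add_assoc]
  -- The failure mass is `1/4` from the recursion plus `1/4` from the grid union bound.
  refine hsub.le_toOuterMeasure hd (Real.sqrt_pos.2 hV) fun T hT hgood => ?_
  have hT0 : T ≠ [] := by
    rintro rfl
    have hlen := Thinformer.length_of_mem_support_compress P _ _ _ g m _ List.length_finRange _ hT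
    exact (by positivity : 2 ^ (2 * g + m) ≠ 0) hlen.symm
  exact (Thinformer.maxNorm_attention_sub_le k v hd (by positivity) q
    (Real.sqrt_nonneg _) hT0 hgood).trans (Thinformer.deviation_le_bound _ _ b hm hb0
      (Real.sqrt_nonneg _) (Real.sq_sqrt hV.le))
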